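/- Let $C\ge 1$. (a) The free-flight flow $\Phi_t(x,v)=(x+tv,v)$ on phase space $\mathbb{R}^C\times\mathbb{R}^C$ is the flow of the vector field $b(x,v)=(v,0)$, and it is divergence-free: $\operatorname{div}_{x,v} b=0$, and every $\Phi_t$, $t\in\mathbb{R}$, preserves Lebesgue measure. Moreover $v\cdot\nabla_x g=\operatorname{div}_{x,v}(g\,b)$ at every point $(x,v)$ where $g:\mathbb{R}^C\times\mathbb{R}^C\to\mathbb{R}$ is differentiable, so the transport equation $\partial_t f+v\cdot\nabla_x f=0$ is in conservation form. (b) Let $\Omega\subset\mathbb{R}^C$ be open, let $G=\partial\Omega$ with surface measure $dS$ (the normalized $(C-1)$-dimensional Hausdorff measure), and suppose that, at $dS$-almost every point of $G$, the boundary is of class $C^1$ with $\Omega$ on one side; let $n$ be the outward unit normal at such points. Let $f(x,v,t)$ (a measurable interior phase-space density, with boundary values at points of $G$) and $f_G(x,v,t)$ (the density accumulated on $G$) solve the transport equation with sticking boundary: 1. $\partial_t f+v\cdot\nabla_x f=0$ for $x\in\Omega$, $v\in\mathbb{R}^C$, $t\ge 0$, in the sense that the derivative of $f$ in the direction $(v,0,1)$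 of $(x,v,t)$-space exists and vanishes (one-sided at $t=0$); 2. for $t>0$ and $x\in G$ where $n(x)$ exists, $f(x,v,t)$ is the limit of $f$ along the trajectory arriving at $x$ if $v\cdot n(x)>0$, and along the trajectory departing from $x$ if $v\cdot n(x)<0$; 3. stuck particles do not leave the boundary: $f(x,v,t)=0$ for $t>0$ and $x\in G$ with $v\cdot n(x)<0$; 4. $\partial_t f_G(x,v,t)=(v\cdot n(x))_+\,f(x,v,t)$ on $G$: for almost every $(x,v)\in G\times\mathbb{R}^C$, the function $f_G(x,v,\cdot)$ is absolutely continuous on bounded intervals of $[0,\infty)$ and the equation holds for almost every $t>0$. Suppose that $f(\cdot,\cdot,0)$ is integrable on $\Omega\times\mathbb{R}^C$ and $f_G(\cdot,\cdot,0)$ is integrable on $G\times\mathbb{R}^C$ with respect to $dS\,dv$. Then for every $t\ge 0$ the functions $f(\cdot,\cdot,t)$ and $f_G(\cdot,\cdot,t)$ are integrable on these sets, and the total mass $$\int_\Omega\int_{\mathbb{R}^C} f(x,v,t)\,dv\,dx+\int_G\int_{\mathbb{R}^C} f_G(x,v,t)\,dv\,dS(x)$$ is equal to its value at $t=0$; in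 particular its time derivative vanishes for all $t\ge0$ (one-sided at $t=0$). If in addition $f(x,v,0)\ge 0$ for all $x\in\Omega$, $v\in\mathbb{R}^C$, then the first integral is nonincreasing and the second is nondecreasing in $t\in[0,\infty)$: mass is redistributed from the interior to the boundary. -/

import Mathlib

open MeasureTheory Set Filter Topology

noncomputable section

/-- The space `ℝ^C` with its Euclidean norm. -/
abbrev Eucl (C : ℕ) : Type := EuclideanSpace ℝ (Fin C)

/-! ### Free flight in phase space -/

/-- The generating vector field `(x, v) ↦ (v, 0)` of free flight (`ẋ = v`, `v̇ = 0`). -/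
def freeFlightField {C : ℕ} (p : Eucl C × Eucl C) : Eucl C × Eucl C := (p.2, 0)

/-- The free-flight flow `(x, v) ↦ (x + t v, v)`. -/
def freeFlightFlow {C : ℕ} (t : ℝ) (p : Eucl C × Eucl C) : Eucl C × Eucl C :=
  (p.1 + t • p.2, p.2)

/-- The divergence (trace of the derivative) of a vector field on phase space. -/
def phaseDivergence {C : ℕ} (X : Eucl C × Eucl C → Eucl C × Eucl C) (p : Eucl C × Eucl C) : ℝ :=
  LinearMap.trace ℝ (Eucl C × Eucl C) (fderiv ℝ X p : (Eucl C × Eucl C) →ₗ[ℝ] (Eucl C × Eucl C))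

/-! ### The boundary, its outward unit normal and its surface measure -/

/-- `n` is the outward unit normal of `Ω` at `x`, and `∂Ω` is of class `C¹` at `x`: near `x` the
set `Ω` is the sublevel set `{ρ < 0}` of a `C¹` function `ρ` with `ρ x = 0` and `∇ρ(x) ≠ 0`, and
`n = ∇ρ(x) / ‖∇ρ(x)‖`. -/
def IsOutwardUnitNormal {C : ℕ} (Ω : Set (Eucl C)) (x n : Eucl C) : Prop :=
  ∃ ρ : Eucl C → ℝ, ContDiffAt ℝ 1 ρ x ∧ ρ x = 0 ∧ gradient ρ x ≠ 0 ∧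
    (∀ᶠ y in 𝓝 x, (y ∈ Ω ↔ ρ y < 0)) ∧ n = ‖gradient ρ x‖⁻¹ • gradient ρ x

/-- The outward unit normal is unique. -/
theorem IsOutwardUnitNormal.unique {C : ℕ} {Ω : Set (Eucl C)} {x n n' : Eucl C}
    (h : IsOutwardUnitNormal Ω x n) (h' : IsOutwardUnitNormal Ω x n') : n = n' := by
  obtain ⟨ρ, hρ, hx, hg, hΩ, rfl⟩ := h
  obtain ⟨ρ', hρ', hx', hg', hΩ', rfl⟩ := h'
  have hG : ∀ {σ : Eucl C → ℝ}, ContDiffAt ℝ 1 σ x → ∀ w : Eucl C,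
      HasDerivAt (fun s : ℝ => σ (x + s • w)) (inner ℝ (gradient σ x) w) 0 := by
    intro σ hσ w
    have h1 := (hσ.differentiableAt one_ne_zero).hasGradientAt.hasFDerivAt
    have h2 := h1.hasLineDerivAt w
    simpa [HasLineDerivAt] using h2
  have hline : ∀ w : Eucl C, Tendsto (fun s : ℝ => x + s • w) (𝓝[>] 0) (𝓝 x) := by
    intro w
    have : Continuous (fun s : ℝ => x + s • w) := by fun_prop
    simpa using (this.tendsto 0).mono_left nhdsWithin_le_nhds
  have key : ∀ w : Eucl C, inner ℝ (gradient ρ x) w < 0 → inner ℝ (gradient ρ' x) w ≤ 0 := by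
    intro w hw
    have e1 : ∀ᶠ s : ℝ in 𝓝[>] 0, ρ (x + s • w) < 0 := by
      have h3 := (hasDerivAt_iff_tendsto_slope.1 (hG hρ w)).eventually (gt_mem_nhds hw)
      have h4 := h3.filter_mono (nhdsWithin_mono (0 : ℝ) (s := Ioi 0) (fun s hs => ne_of_gt hs))
      filter_upwards [h4, self_mem_nhdsWithin] with s hs hs0
      have hs0' : (0 : ℝ) < s := hs0
      simp only [slope_def_field, zero_smul, add_zero, hx, sub_zero] at hs
      by_contra hc
      exact absurd hs (not_lt.2 (div_nonneg (not_lt.1 hc) hs0'.le))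
    have e2 : ∀ᶠ s : ℝ in 𝓝[>] 0, ρ' (x + s • w) < 0 := by
      filter_upwards [e1, (hline w).eventually hΩ, (hline w).eventually hΩ'] with s a b c
      exact c.1 (b.2 a)
    have h3 := (hasDerivAt_iff_tendsto_slope.1 (hG hρ' w)).mono_left
      (nhdsWithin_mono (0 : ℝ) (s := Ioi 0) (fun s hs => ne_of_gt hs))
    refine le_of_tendsto h3 ?_
    filter_upwards [e2, self_mem_nhdsWithin] with s hs hs0
    have hs0' : (0 : ℝ) < s := hs0
    simp only [slope_def_field, zero_smul, add_zero, hx', sub_zero]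
    exact div_nonpos_of_nonpos_of_nonneg hs.le hs0'.le
  set a := ‖gradient ρ x‖⁻¹ • gradient ρ x with ha
  set b := ‖gradient ρ' x‖⁻¹ • gradient ρ' x with hb
  have pa : 0 < ‖gradient ρ x‖⁻¹ := inv_pos.2 (norm_pos_iff.2 hg)
  have pb : 0 < ‖gradient ρ' x‖⁻¹ := inv_pos.2 (norm_pos_iff.2 hg')
  have na : ‖a‖ = 1 := norm_smul_inv_norm hg
  have nb : ‖b‖ = 1 := norm_smul_inv_norm hg'
  by_contra hne
  have hlt : inner ℝ a b < 1 := inner_lt_one_iff_real_of_norm_eq_one na nb |>.2 hne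
  have haa : inner ℝ a a = 1 := by rw [real_inner_self_eq_norm_sq, na]; norm_num
  have hbb : inner ℝ b b = 1 := by rw [real_inner_self_eq_norm_sq, nb]; norm_num
  have k1 : inner ℝ a (b - a) < 0 := by rw [inner_sub_right, haa]; linarith
  have k2 : 0 < inner ℝ b (b - a) := by
    rw [inner_sub_right, hbb, real_inner_comm]; linarith
  rw [ha, real_inner_smul_left, ← ha] at k1
  rw [hb, real_inner_smul_left, ← hb] at k2
  have k1' : inner ℝ (gradient ρ x) (b - a) < 0 := by
    by_contra hc
    exact absurd k1 (not_lt.2 (mul_nonneg pa.le (not_lt.1 hc)))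
  have k2' : 0 < inner ℝ (gradient ρ' x) (b - a) := pos_of_mul_pos_right k2 pb.le
  exact absurd (key _ k1') (not_le.2 k2')

open Classical in
/-- The outward unit normal `n(x)` of `Ω`; by convention `0` where `∂Ω` is not of class `C¹`. -/
def outwardNormal {C : ℕ} (Ω : Set (Eucl C)) (x : Eucl C) : Eucl C :=
  if h : ∃ n, IsOutwardUnitNormal Ω x n then h.choose else 0

/-- The surface measure `dS` of `G = ∂Ω`: the `(C - 1)`-dimensional Hausdorff measure (in its
Euclidean normalization) restricted to `∂Ω`. -/
def surfaceMeasure {C : ℕ} (Ω : Set (Eucl C)) : Measure (Eucl C) :=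
  (μHE[C - 1] : Measure (Eucl C)).restrict (frontier Ω)

/-- `∂Ω` is of class `C¹`, with `Ω` on one side, outside a set of surface measure zero (such as the
edges and corners of a polyhedron). -/
def HasAEC1Boundary {C : ℕ} (Ω : Set (Eucl C)) : Prop :=
  ∀ᵐ x ∂(surfaceMeasure Ω), ∃ n, IsOutwardUnitNormal Ω x n

/-! ### Transport with a sticking boundary -/

/-- For differentiable `f`, the derivative along `(v, 0, 1)` is `∂ₜ f + v · ∇ₓ f`. -/
theorem lineDeriv_eq_transport {C : ℕ} (f : Eucl C → Eucl C → ℝ → ℝ) (x v : Eucl C) (t : ℝ)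
    (hf : DifferentiableAt ℝ (fun q : Eucl C × Eucl C × ℝ => f q.1 q.2.1 q.2.2) (x, v, t)) :
    lineDeriv ℝ (fun q : Eucl C × Eucl C × ℝ => f q.1 q.2.1 q.2.2) (x, v, t) (v, 0, 1) =
      deriv (fun s => f x v s) t + inner ℝ v (gradient (fun y => f y v t) x) := by
  have h := hf.hasFDerivAt
  set F' := fderiv ℝ (fun q : Eucl C × Eucl C × ℝ => f q.1 q.2.1 q.2.2) (x, v, t)
  have ht : HasDerivAt (fun s => f x v s) (F' (0, 0, 1)) t := by
    have g : HasDerivAt (fun s : ℝ => ((x, v, s) : Eucl C × Eucl C × ℝ)) (0, 0, 1) t :=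
      (hasDerivAt_const t x).prodMk ((hasDerivAt_const t v).prodMk (hasDerivAt_id t))
    exact h.comp_hasDerivAt t g
  have hx : HasFDerivAt (fun y => f y v t)
      (F'.comp ((ContinuousLinearMap.id ℝ (Eucl C)).prod 0)) x := by
    have g : HasFDerivAt (fun y : Eucl C => ((y, v, t) : Eucl C × Eucl C × ℝ))
        ((ContinuousLinearMap.id ℝ (Eucl C)).prod 0) x :=
      (hasFDerivAt_id x).prodMk (hasFDerivAt_const ((v, t) : Eucl C × ℝ) x)
    exact HasFDerivAt.comp x h g
  rw [h.hasLineDerivAt (v, 0, 1) |>.lineDeriv, ht.deriv, real_inner_comm,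
    inner_gradient_left, hx.fderiv]
  simp [← map_add]

/-- `(f, fG)` solves the collisionless transport equation in `Ω` with sticking boundary `∂Ω`.
Here `f x v t` is the phase-space density, its values at boundary points being its one-sided limits
along trajectories, and `fG x v t` is the density accumulated on the boundary.

Densities need not be smooth or even continuous (think of particles that are uniformly distributed
initially, or of shadows behind obstacles); hence `∂ₜ f + v · ∇ₓ f` is read as the derivative of
`f` along the phase-space-time direction `(v, 0, 1)`, which it equals for differentiable `f`, and
the equation for `fG` holds in the sense of Carathéodory. -/
structure IsStickingTransportSolution {C : ℕ} (Ω : Set (Eucl C))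
    (f fG : Eucl C → Eucl C → ℝ → ℝ) : Prop where
  measurable : Measurable (fun q : Eucl C × Eucl C × ℝ => f q.1 q.2.1 q.2.2)
  /-- `∂ₜ f + v · ∇ₓ f = 0` on `Ω × ℝ^C × [0, ∞)` (one-sided at the initial time). -/
  transport : ∀ x ∈ Ω, ∀ v : Eucl C, ∀ t : ℝ, 0 ≤ t →
    HasLineDerivWithinAt ℝ (fun q : Eucl C × Eucl C × ℝ => f q.1 q.2.1 q.2.2) 0
      (Ω ×ˢ (univ ×ˢ Ici 0)) (x, v, t) (v, 0, 1)
  /-- Outgoing boundary values are limits along the trajectories that arrive. -/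
  outgoing_trace : ∀ x ∈ frontier Ω, ∀ v : Eucl C, 0 < inner ℝ v (outwardNormal Ω x) →
    ∀ t : ℝ, 0 < t → Tendsto (fun s : ℝ => f (x - s • v) v (t - s)) (𝓝[>] 0) (𝓝 (f x v t))
  /-- Incoming boundary values are limits along the trajectories that would depart. -/
  incoming_trace : ∀ x ∈ frontier Ω, ∀ v : Eucl C, inner ℝ v (outwardNormal Ω x) < 0 →
    ∀ t : ℝ, 0 < t → Tendsto (fun s : ℝ => f (x + s • v) v (t + s)) (𝓝[>] 0) (𝓝 (f x v t))
  /-- Stuck particles remain stuck: no particle enters `Ω` from the boundary. -/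
  no_inflow : ∀ x ∈ frontier Ω, ∀ v : Eucl C, inner ℝ v (outwardNormal Ω x) < 0 →
    ∀ t : ℝ, 0 < t → f x v t = 0
  /-- `∂ₜ fG = (v · n)₊ f` on `∂Ω × ℝ^C`: for almost every `(x, v)`, the function `fG x v` is
  absolutely continuous on bounded time intervals and the equation holds at almost every time. -/
  accumulation : ∀ᵐ p : Eucl C × Eucl C ∂((surfaceMeasure Ω).prod volume),
    (∀ T : ℝ, 0 ≤ T → AbsolutelyContinuousOnInterval (fG p.1 p.2) 0 T) ∧
    ∀ᵐ t : ℝ, 0 < t →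
      HasDerivAt (fG p.1 p.2) (max (inner ℝ p.2 (outwardNormal Ω p.1)) 0 * f p.1 p.2 t) t

/-- The mass in the interior, `∫_Ω ∫ f(x, v, t) dv dx`. -/
def interiorMass {C : ℕ} (Ω : Set (Eucl C)) (f : Eucl C → Eucl C → ℝ → ℝ) (t : ℝ) : ℝ :=
  ∫ x in Ω, ∫ v, f x v t

/-- The mass accumulated on the boundary, `∫_{∂Ω} ∫ fG(x, v, t) dv dS(x)`. -/
def boundaryMass {C : ℕ} (Ω : Set (Eucl C)) (fG : Eucl C → Eucl C → ℝ → ℝ) (t : ℝ) : ℝ :=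
  ∫ x, (∫ v, fG x v t) ∂(surfaceMeasure Ω)

end

/-!
A particle of velocity `v` moves on a straight line until it meets `∂Ω`, where it stays. The proof
follows the particles rather than differentiating under the integral sign.

Fix `v ≠ 0`. Along a segment in `Ω` the density is constant (`const_along`), and on a segment that
comes from a regular boundary point which it meets transversally the density is zero, by the
no-inflow condition (`eq_zero_of_exit`). Lines that meet `∂Ω` tangentially or at a singular point
fill a null set (`volume_badLines`). Hence, almost everywhere, the interior density at time `t` is
the initial density on the set `survivors Ω t` of states that have not left `Ω`, carried along by
the measure preserving free flight (`interior_ae_eq`). In the same way, the flux `(v · n)₊ f`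
through `x ∈ ∂Ω` at time `s` is `|v · n|` times the initial density at `x - s v` if the particle
starting there first meets the boundary at `x`, and is zero otherwise (`accumulationRate_ae_eq`).

The two descriptions are compared by the area formula `volume_retrace_image`: the map
`(x, s) ↦ x - s v` from `∂Ω × ℝ` to space has Jacobian `|v · n(x)|` with respect to `dS ds`, and it
is injective on first arrivals. So the mass accumulated by time `t` is the initial mass of the set
`leavers Ω t`, the complement of `survivors Ω t` in `Ω × ℝ^C` (`boundaryMass_eq`), and the total is
conserved. If the initial density is nonnegative, the interior mass decreases because
`survivors Ω t` does.

The area formula itself needs no parametrization of the surface. Near a regular point with normal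
`n₀` the boundary is a `δ`-Lipschitz graph over its tangent plane (`exists_isFlat`). Projecting to
this plane along `n₀` changes the Hausdorff measure by a factor at most `(1 + δ)^(C-1)`, and
`P x + s n₀ ↦ x - s v` is `δ`-close to a linear map of determinant `± v · n₀`, so that it changes
volume by a factor close to `|v · n₀|`. Summing over small pieces and letting the error tend to zero
gives the formula; in particular the surface measure is `σ`-finite and tangential directions
contribute nothing.
-/

noncomputable section

/-! ### Free flight -/

theorem hasDerivAt_freeFlightFlow {C : ℕ} (p : Eucl C × Eucl C) (t : ℝ) :
    HasDerivAt (fun s : ℝ => freeFlightFlow s p) (freeFlightField (freeFlightFlow t p)) t := by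
  have h1 : HasDerivAt (fun s : ℝ => p.1 + s • p.2) p.2 t := by
    simpa using ((hasDerivAt_id t).smul_const p.2).const_add p.1
  exact h1.prodMk (hasDerivAt_const t p.2)

/-- The free-flight field as a continuous linear map. -/
def freeFlightCLM (C : ℕ) : (Eucl C × Eucl C) →L[ℝ] (Eucl C × Eucl C) :=
  (ContinuousLinearMap.inl ℝ (Eucl C) (Eucl C)).comp (ContinuousLinearMap.snd ℝ (Eucl C) (Eucl C))

theorem trace_freeFlightCLM (C : ℕ) :
    LinearMap.trace ℝ (Eucl C × Eucl C)
      (freeFlightCLM C : (Eucl C × Eucl C) →ₗ[ℝ] (Eucl C × Eucl C)) = 0 := by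
  have h : (freeFlightCLM C : (Eucl C × Eucl C) →ₗ[ℝ] (Eucl C × Eucl C)) =
      (LinearMap.inl ℝ (Eucl C) (Eucl C)) ∘ₗ (LinearMap.snd ℝ (Eucl C) (Eucl C)) := rfl
  rw [h, LinearMap.trace_comp_comm']
  have h0 : (LinearMap.snd ℝ (Eucl C) (Eucl C)) ∘ₗ (LinearMap.inl ℝ (Eucl C) (Eucl C)) = 0 := by
    ext; simp
  rw [h0, map_zero]

theorem phaseDivergence_freeFlightField {C : ℕ} (p : Eucl C × Eucl C) :
    phaseDivergence freeFlightField p = 0 := by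
  have h : HasFDerivAt (freeFlightField : Eucl C × Eucl C → Eucl C × Eucl C)
      (freeFlightCLM C) p := (freeFlightCLM C).hasFDerivAt
  rw [phaseDivergence, h.fderiv, trace_freeFlightCLM]

theorem continuous_freeFlightFlow {C : ℕ} (t : ℝ) :
    Continuous (freeFlightFlow t : Eucl C × Eucl C → Eucl C × Eucl C) := by
  unfold freeFlightFlow; fun_prop

theorem measurePreserving_freeFlightFlow {C : ℕ} (t : ℝ) :
    MeasurePreserving (freeFlightFlow t : Eucl C × Eucl C → Eucl C × Eucl C) volume volume := by
  have h : MeasurePreserving (fun q : Eucl C × Eucl C => (q.1, q.2 + t • q.1))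
      (volume.prod volume) (volume.prod volume) := by
    refine (MeasurePreserving.id volume).skew_product (g := fun v x => x + t • v)
      (by fun_prop) (Eventually.of_forall fun v => ?_)
    exact map_add_right_eq_self volume (t • v)
  exact (Measure.measurePreserving_swap.comp h).comp Measure.measurePreserving_swap

/-- By the product rule, the divergence of `g b` is `∇g · b + g div b`, and `div b = 0`. -/
theorem inner_gradient_eq_phaseDivergence {C : ℕ} (g : Eucl C × Eucl C → ℝ) (p : Eucl C × Eucl C)
    (hg : DifferentiableAt ℝ g p) :
    inner ℝ p.2 (gradient (fun x : Eucl C => g (x, p.2)) p.1) =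
      phaseDivergence (fun q => g q • freeFlightField q) p := by
  have h1 : HasFDerivAt (fun q => g q • freeFlightField q)
      (g p • freeFlightCLM C + (fderiv ℝ g p).smulRight (freeFlightField p)) p :=
    hg.hasFDerivAt.smul (freeFlightCLM C).hasFDerivAt
  have h2 : HasFDerivAt (fun x : Eucl C => g (x, p.2))
      ((fderiv ℝ g p).comp (ContinuousLinearMap.inl ℝ (Eucl C) (Eucl C))) p.1 := by
    have e : HasFDerivAt (fun x : Eucl C => (x, p.2))
        (ContinuousLinearMap.inl ℝ (Eucl C) (Eucl C)) p.1 := hasFDerivAt_prodMk_left p.1 p.2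
    exact HasFDerivAt.comp p.1 (g := g) (f := fun x : Eucl C => (x, p.2)) hg.hasFDerivAt e
  rw [phaseDivergence, h1.fderiv, real_inner_comm, inner_gradient_left, h2.fderiv]
  have h3 : ((g p • freeFlightCLM C + (fderiv ℝ g p).smulRight (freeFlightField p) :
      (Eucl C × Eucl C) →L[ℝ] (Eucl C × Eucl C)) : (Eucl C × Eucl C) →ₗ[ℝ] (Eucl C × Eucl C)) =
      g p • (freeFlightCLM C : (Eucl C × Eucl C) →ₗ[ℝ] (Eucl C × Eucl C)) +
        ((fderiv ℝ g p : (Eucl C × Eucl C) →ₗ[ℝ] ℝ).smulRight (freeFlightField p)) := rfl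
  rw [h3, map_add, map_smul, trace_freeFlightCLM, LinearMap.trace_smulRight]
  simp [freeFlightField]

/-! ### The regular part of the boundary -/

/-- The points at which `∂Ω` is of class `C¹` with `Ω` on one side. -/
def regularBoundary {C : ℕ} (Ω : Set (Eucl C)) : Set (Eucl C) :=
  {x | ∃ n, IsOutwardUnitNormal Ω x n}

section Regular

variable {C : ℕ} {Ω : Set (Eucl C)}

theorem isOutwardUnitNormal_outwardNormal {x : Eucl C} (hx : x ∈ regularBoundary Ω) :
    IsOutwardUnitNormal Ω x (outwardNormal Ω x) := by
  have hx' : ∃ n, IsOutwardUnitNormal Ω x n := hx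
  rw [outwardNormal, dif_pos hx']
  exact hx'.choose_spec

theorem IsOutwardUnitNormal.outwardNormal_eq {x n : Eucl C} (h : IsOutwardUnitNormal Ω x n) :
    outwardNormal Ω x = n :=
  (isOutwardUnitNormal_outwardNormal ⟨n, h⟩).unique h

theorem outwardNormal_eq_zero {x : Eucl C} (hx : x ∉ regularBoundary Ω) :
    outwardNormal Ω x = 0 := by
  have hx' : ¬ ∃ n, IsOutwardUnitNormal Ω x n := hx
  rw [outwardNormal, dif_neg hx']

theorem IsOutwardUnitNormal.norm_eq_one {x n : Eucl C} (h : IsOutwardUnitNormal Ω x n) :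
    ‖n‖ = 1 := by
  obtain ⟨ρ, -, -, hg, -, rfl⟩ := h
  exact norm_smul_inv_norm hg

theorem IsOutwardUnitNormal.notMem {x n : Eucl C} (h : IsOutwardUnitNormal Ω x n) : x ∉ Ω := by
  obtain ⟨ρ, -, hx, -, hΩ, -⟩ := h
  intro hxΩ
  exact (hΩ.self_of_nhds.1 hxΩ).ne hx

theorem tendsto_add_smul_nhdsGT {C : ℕ} (x w : Eucl C) :
    Tendsto (fun s : ℝ => x + s • w) (𝓝[>] 0) (𝓝 x) := by
  have : Continuous (fun s : ℝ => x + s • w) := by fun_prop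
  simpa using (this.tendsto 0).mono_left nhdsWithin_le_nhds

theorem tendsto_slope_along {ρ : Eucl C → ℝ} {x : Eucl C} (hρ : ContDiffAt ℝ 1 ρ x) (hx : ρ x = 0)
    (w : Eucl C) :
    Tendsto (fun s : ℝ => ρ (x + s • w) / s) (𝓝[>] 0) (𝓝 (inner ℝ (gradient ρ x) w)) := by
  have h1 := (hρ.differentiableAt one_ne_zero).hasGradientAt.hasFDerivAt
  have h2 : HasDerivAt (fun s : ℝ => ρ (x + s • w)) (inner ℝ (gradient ρ x) w) 0 := by
    simpa [HasLineDerivAt] using h1.hasLineDerivAt w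
  have h3 := (hasDerivAt_iff_tendsto_slope.1 h2).mono_left
    (nhdsWithin_mono (0 : ℝ) (s := Ioi 0) (fun s hs => ne_of_gt hs))
  refine h3.congr fun s => ?_
  simp [slope_def_field, hx]

theorem IsOutwardUnitNormal.eventually_mem {x n w : Eucl C} (h : IsOutwardUnitNormal Ω x n)
    (hw : inner ℝ n w < 0) : ∀ᶠ s : ℝ in 𝓝[>] 0, x + s • w ∈ Ω := by
  obtain ⟨ρ, hρ, hx, hg, hΩ, rfl⟩ := h
  rw [real_inner_smul_left] at hw
  have hw' : inner ℝ (gradient ρ x) w < 0 := by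
    by_contra hc
    exact absurd hw (not_lt.2 (mul_nonneg (by positivity) (not_lt.1 hc)))
  filter_upwards [(tendsto_slope_along hρ hx w).eventually (gt_mem_nhds hw'),
    (tendsto_add_smul_nhdsGT x w).eventually hΩ, self_mem_nhdsWithin] with s h1 h2 (h3 : 0 < s)
  exact h2.2 ((div_lt_iff₀ h3).1 h1 |>.trans_eq (zero_mul s))

theorem IsOutwardUnitNormal.eventually_notMem {x n w : Eucl C} (h : IsOutwardUnitNormal Ω x n)
    (hw : 0 < inner ℝ n w) : ∀ᶠ s : ℝ in 𝓝[>] 0, x + s • w ∉ Ω := by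
  obtain ⟨ρ, hρ, hx, hg, hΩ, rfl⟩ := h
  rw [real_inner_smul_left] at hw
  have hw' : 0 < inner ℝ (gradient ρ x) w := pos_of_mul_pos_right hw (by positivity)
  filter_upwards [(tendsto_slope_along hρ hx w).eventually (lt_mem_nhds hw'),
    (tendsto_add_smul_nhdsGT x w).eventually hΩ, self_mem_nhdsWithin] with s h1 h2 (h3 : 0 < s)
  intro h4
  have := (lt_div_iff₀ h3).1 h1
  linarith [h2.1 h4]

theorem regularBoundary_subset_frontier : regularBoundary Ω ⊆ frontier Ω := by
  rintro x ⟨n, h⟩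
  refine ⟨?_, fun hx => h.notMem (interior_subset hx)⟩
  have hw : inner ℝ n (-n) < 0 := by
    rw [inner_neg_right, real_inner_self_eq_norm_sq, h.norm_eq_one]; norm_num
  exact mem_closure_of_tendsto (tendsto_add_smul_nhdsGT x (-n)) (h.eventually_mem hw)

/-- Near a regular point with defining function `ρ`, the boundary is the zero set of `ρ`, it
consists of regular points, and its normal is the normalized gradient of `ρ`. -/
theorem eventually_regular (hΩo : IsOpen Ω) {x : Eucl C} {ρ : Eucl C → ℝ}
    (hρ : ContDiffAt ℝ 1 ρ x) (hg : gradient ρ x ≠ 0) (hΩ : ∀ᶠ y in 𝓝 x, (y ∈ Ω ↔ ρ y < 0)) :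
    ContinuousAt (gradient ρ) x ∧ ∀ᶠ y in 𝓝 x, y ∈ frontier Ω → ρ y = 0 ∧
      IsOutwardUnitNormal Ω y (‖gradient ρ y‖⁻¹ • gradient ρ y) := by
  have hc : ContinuousAt (gradient ρ) x := by
    have h1 : ContinuousAt (fderiv ℝ ρ) x := (hρ.fderiv_right (m := 0) (by simp)).continuousAt
    exact (InnerProductSpace.toDual ℝ (Eucl C)).symm.continuous.continuousAt.comp h1
  refine ⟨hc, ?_⟩
  filter_upwards [hρ.eventually (by simp), hc.eventually_ne hg, eventually_eventually_nhds.2 hΩ]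
    with y h1 h2 h3 hy
  have h0 : ρ y = 0 := by
    refine le_antisymm ?_ ?_
    · by_contra hpos
      have h4 : ∀ᶠ z in 𝓝 y, 0 < ρ z := h1.continuousAt.eventually (lt_mem_nhds (not_le.1 hpos))
      have h5 : ∃ᶠ z in 𝓝 y, z ∈ Ω := mem_closure_iff_frequently.1 hy.1
      obtain ⟨z, hz, hz1, hz2⟩ := (h5.and_eventually (h3.and h4)).exists
      linarith [hz1.1 hz]
    · by_contra hneg
      have : y ∈ Ω := h3.self_of_nhds.2 (not_le.1 hneg)
      rw [hΩo.frontier_eq] at hy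
      exact hy.2 this
  exact ⟨h0, ρ, h1, h0, h2, h3, rfl⟩

theorem eventually_mem_regularBoundary (hΩo : IsOpen Ω) {x : Eucl C}
    (hx : x ∈ regularBoundary Ω) : ∀ᶠ y in 𝓝 x, y ∈ frontier Ω → y ∈ regularBoundary Ω := by
  obtain ⟨n, ρ, hρ, -, hg, hΩ, -⟩ := hx
  filter_upwards [(eventually_regular hΩo hρ hg hΩ).2] with y hy hy'
  exact ⟨_, (hy hy').2⟩

theorem measurableSet_regularBoundary (hΩo : IsOpen Ω) : MeasurableSet (regularBoundary Ω) := by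
  have h : regularBoundary Ω =
      frontier Ω ∩ interior {y | y ∈ frontier Ω → y ∈ regularBoundary Ω} := by
    apply Subset.antisymm
    · exact fun x hx => ⟨regularBoundary_subset_frontier hx,
        mem_interior_iff_mem_nhds.2 (eventually_mem_regularBoundary hΩo hx)⟩
    · exact fun x hx => interior_subset hx.2 hx.1
  rw [h]
  exact isClosed_frontier.measurableSet.inter isOpen_interior.measurableSet

theorem continuousOn_outwardNormal (hΩo : IsOpen Ω) :
    ContinuousOn (outwardNormal Ω) (frontier Ω ∩ regularBoundary Ω) := by
  rintro x ⟨-, n, ρ, hρ, h0, hg, hΩ, hn⟩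
  obtain ⟨hc, he⟩ := eventually_regular hΩo hρ hg hΩ
  have h1 : ContinuousAt (fun y => ‖gradient ρ y‖⁻¹ • gradient ρ y) x :=
    (hc.norm.inv₀ (norm_ne_zero_iff.2 hg)).smul hc
  refine h1.continuousWithinAt.congr_of_eventuallyEq ?_ ?_
  · filter_upwards [mem_nhdsWithin_of_mem_nhds he, self_mem_nhdsWithin] with y hy hy'
    exact (hy hy'.1).2.outwardNormal_eq
  · exact IsOutwardUnitNormal.outwardNormal_eq ⟨ρ, hρ, h0, hg, hΩ, rfl⟩

theorem measurable_outwardNormal (hΩo : IsOpen Ω) : Measurable (outwardNormal Ω) := by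
  classical
  have hm := measurableSet_regularBoundary hΩo
  have hc : ContinuousOn (outwardNormal Ω) (regularBoundary Ω) :=
    (continuousOn_outwardNormal hΩo).mono fun x hx => ⟨regularBoundary_subset_frontier hx, hx⟩
  have h : outwardNormal Ω = (regularBoundary Ω).piecewise (outwardNormal Ω) (fun _ => 0) := by
    ext1 x
    by_cases hx : x ∈ regularBoundary Ω
    · simp [hx]
    · simp [hx, outwardNormal_eq_zero hx]
  rw [h]
  exact hc.measurable_piecewise continuousOn_const hm

/-- Near a regular point the boundary stays close to its tangent plane, to first order. -/
theorem eventually_abs_inner_sub_le (hΩo : IsOpen Ω) {x₀ : Eucl C} (hx : x₀ ∈ regularBoundary Ω)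
    {δ : ℝ} (hδ : 0 < δ) :
    ∃ U ∈ 𝓝 x₀, ∀ x ∈ U ∩ frontier Ω, ∀ y ∈ U ∩ frontier Ω,
      |inner ℝ (outwardNormal Ω x₀) (x - y)| ≤ δ * ‖x - y‖ := by
  obtain ⟨n, ρ, hρ, h0, hg, hΩ, hn⟩ := hx
  have hn' : outwardNormal Ω x₀ = ‖gradient ρ x₀‖⁻¹ • gradient ρ x₀ :=
    IsOutwardUnitNormal.outwardNormal_eq ⟨ρ, hρ, h0, hg, hΩ, rfl⟩
  have hpos : 0 < ‖gradient ρ x₀‖ := norm_pos_iff.2 hg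
  have hs := (hρ.hasStrictFDerivAt one_ne_zero).isLittleO.def (mul_pos hδ hpos)
  obtain ⟨U, hU, V, hV, hUV⟩ := mem_nhds_prod_iff.1 hs
  refine ⟨U ∩ V ∩ {y | y ∈ frontier Ω → ρ y = 0 ∧
    IsOutwardUnitNormal Ω y (‖gradient ρ y‖⁻¹ • gradient ρ y)},
    inter_mem (inter_mem hU hV) (eventually_regular hΩo hρ hg hΩ).2, ?_⟩
  rintro x ⟨⟨⟨hx1, -⟩, hx2⟩, hx3⟩ y ⟨⟨⟨-, hy1⟩, hy2⟩, hy3⟩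
  have h1 : ‖ρ x - ρ y - (fderiv ℝ ρ x₀) (x - y)‖ ≤ δ * ‖gradient ρ x₀‖ * ‖x - y‖ :=
    hUV (mk_mem_prod hx1 hy1)
  rw [(hx2 hx3).1, (hy2 hy3).1, sub_zero, zero_sub, norm_neg, Real.norm_eq_abs] at h1
  rw [hn', real_inner_smul_left, inner_gradient_left, abs_mul, abs_inv, abs_norm,
    inv_mul_le_iff₀ hpos]
  linarith

end Regular

/-! ### Hausdorff measure of nearly flat sets, and volume -/

theorem LipschitzOnWith.euclideanHausdorffMeasure_image_le {X Y : Type*} [EMetricSpace X]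
    [MeasurableSpace X] [BorelSpace X] [EMetricSpace Y] [MeasurableSpace Y] [BorelSpace Y]
    {K : NNReal} {f : X → Y} {s : Set X} (h : LipschitzOnWith K f s) (d : ℕ) :
    (μHE[d] : Measure Y) (f '' s) ≤ (K : ENNReal) ^ d * (μHE[d] : Measure X) s := by
  simp_rw [Measure.euclideanHausdorffMeasure_def, Measure.smul_apply, ENNReal.smul_def, smul_eq_mul]
  rw [mul_left_comm]
  have := h.hausdorffMeasure_image_le (d := d) (by positivity)
  rw [ENNReal.rpow_natCast] at this
  gcongr

section Flatten

variable {C : ℕ}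

/-- The component of `x` orthogonal to the unit vector `n`. -/
def tangentPart (n : Eucl C) : Eucl C →L[ℝ] Eucl C :=
  ContinuousLinearMap.id ℝ (Eucl C) - (innerSL ℝ n).smulRight n

theorem tangentPart_apply (n x : Eucl C) : tangentPart n x = x - inner ℝ n x • n := by
  simp [tangentPart]

theorem inner_tangentPart {n : Eucl C} (hn : ‖n‖ = 1) (x : Eucl C) :
    inner ℝ n (tangentPart n x) = 0 := by
  rw [tangentPart_apply, inner_sub_right, real_inner_smul_right, real_inner_self_eq_norm_sq, hn]
  ring

theorem tangentPart_self {n : Eucl C} (hn : ‖n‖ = 1) : tangentPart n n = 0 := by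
  rw [tangentPart_apply, real_inner_self_eq_norm_sq, hn]; simp

theorem norm_tangentPart_le {n : Eucl C} (hn : ‖n‖ = 1) (x : Eucl C) :
    ‖tangentPart n x‖ ≤ ‖x‖ := by
  have h1 : inner ℝ (tangentPart n x) (tangentPart n x) = inner ℝ (tangentPart n x) x := by
    conv_lhs => rw [tangentPart_apply n x]
    rw [← tangentPart_apply, tangentPart_apply n x, inner_sub_right, real_inner_smul_right,
      ← tangentPart_apply, real_inner_comm n, inner_tangentPart hn]
    ring
  have h2 := real_inner_le_norm (tangentPart n x) x
  rw [← h1, real_inner_self_eq_norm_sq, sq] at h2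
  by_contra hc
  push Not at hc
  nlinarith [norm_nonneg x]

theorem norm_le_norm_tangentPart_add {n : Eucl C} (hn : ‖n‖ = 1) (x : Eucl C) :
    ‖x‖ ≤ ‖tangentPart n x‖ + |inner ℝ n x| := by
  have : x = tangentPart n x + inner ℝ n x • n := by rw [tangentPart_apply]; abel
  calc ‖x‖ = ‖tangentPart n x + inner ℝ n x • n‖ := by rw [← this]
    _ ≤ _ := (norm_add_le _ _).trans (by rw [norm_smul, hn, mul_one, Real.norm_eq_abs])

/-- The map `(x, s) ↦ P x + s n`, where `P` is the orthogonal projection along `n`. It turns a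
hypersurface, thickened by a line, into an open piece of space. -/
def flatten (n : Eucl C) (q : Eucl C × ℝ) : Eucl C := tangentPart n q.1 + q.2 • n

theorem continuous_flatten (n : Eucl C) : Continuous (flatten n) := by
  unfold flatten; fun_prop

theorem inner_flatten {n : Eucl C} (hn : ‖n‖ = 1) (q : Eucl C × ℝ) :
    inner ℝ n (flatten n q) = q.2 := by
  rw [flatten, inner_add_right, inner_tangentPart hn, real_inner_smul_right,
    real_inner_self_eq_norm_sq, hn]
  ring

theorem tangentPart_flatten {n : Eucl C} (hn : ‖n‖ = 1) (q : Eucl C × ℝ) :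
    tangentPart n (flatten n q) = tangentPart n q.1 := by
  rw [flatten, map_add, map_smul, tangentPart_self hn, smul_zero, add_zero,
    tangentPart_apply n (tangentPart n q.1), inner_tangentPart hn, zero_smul, sub_zero]

/-- A set is `δ`-flat in the direction orthogonal to `n` if it is a `δ`-Lipschitz graph over a part
of the hyperplane orthogonal to `n`. -/
def IsFlat (n : Eucl C) (δ : NNReal) (A : Set (Eucl C)) : Prop :=
  ∀ x ∈ A, ∀ y ∈ A, |inner ℝ n (x - y)| ≤ δ * ‖tangentPart n (x - y)‖

theorem IsFlat.mono {n : Eucl C} {δ : NNReal} {A B : Set (Eucl C)} (h : IsFlat n δ A)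
    (hBA : B ⊆ A) : IsFlat n δ B :=
  fun x hx y hy => h x (hBA hx) y (hBA hy)

theorem IsFlat.norm_sub_le {n : Eucl C} (hn : ‖n‖ = 1) {δ : NNReal} {A : Set (Eucl C)}
    (h : IsFlat n δ A) {x y : Eucl C} (hx : x ∈ A) (hy : y ∈ A) :
    ‖x - y‖ ≤ (1 + δ) * ‖tangentPart n x - tangentPart n y‖ := by
  have h1 := norm_le_norm_tangentPart_add hn (x - y)
  have h2 := h x hx y hy
  rw [map_sub] at h1 h2
  linarith

theorem IsFlat.injOn_flatten {n : Eucl C} (hn : ‖n‖ = 1) {δ : NNReal} {A : Set (Eucl C)}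
    (h : IsFlat n δ A) : InjOn (flatten n) (A ×ˢ univ) := by
  rintro ⟨x, s⟩ ⟨hx, -⟩ ⟨y, r⟩ ⟨hy, -⟩ he
  have h1 := inner_flatten hn (x, s)
  have h2 := tangentPart_flatten hn (x, s)
  rw [he, inner_flatten hn] at h1
  rw [he, tangentPart_flatten hn] at h2
  have h3 := h.norm_sub_le hn hx hy
  simp only at h1 h2
  rw [h2, sub_self, norm_zero, mul_zero] at h3
  have h4 : x = y := sub_eq_zero.1 (norm_le_zero_iff.1 h3)
  rw [h4, h1]

/-- The orthogonal projection of a `δ`-flat set changes its surface measure by a factor between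
`1` and `(1 + δ)ᵈ`. -/
theorem IsFlat.euclideanHausdorffMeasure_image {n : Eucl C} (hn : ‖n‖ = 1) {δ : NNReal}
    {D : Set (Eucl C)} (h : IsFlat n δ D) (d : ℕ) (s : ℝ) :
    (μHE[d] : Measure (Eucl C)) ((fun x => flatten n (x, s)) '' D) ≤
        (μHE[d] : Measure (Eucl C)) D ∧
      (μHE[d] : Measure (Eucl C)) D ≤ ((1 + δ : NNReal) : ENNReal) ^ d *
        (μHE[d] : Measure (Eucl C)) ((fun x => flatten n (x, s)) '' D) := by
  set g : Eucl C → Eucl C := fun x => flatten n (x, s) with hg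
  have hsub : ∀ x y, g x - g y = tangentPart n x - tangentPart n y := by
    intro x y; simp [hg, flatten]
  constructor
  · have hL : LipschitzOnWith 1 g D := by
      refine LipschitzOnWith.of_dist_le_mul fun x _ y _ => ?_
      rw [dist_eq_norm, dist_eq_norm, hsub, ← map_sub, NNReal.coe_one, one_mul]
      exact norm_tangentPart_le hn _
    simpa using hL.euclideanHausdorffMeasure_image_le d
  · have hinj : InjOn g D := by
      intro x hx y hy he
      have := h.injOn_flatten hn (mk_mem_prod hx (mem_univ s)) (mk_mem_prod hy (mem_univ s)) he
      exact congrArg Prod.fst this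
    have hinv := hinj.leftInvOn_invFunOn
    have hL : LipschitzOnWith (1 + δ) (Function.invFunOn g D) (g '' D) := by
      refine LipschitzOnWith.of_dist_le_mul ?_
      rintro _ ⟨x, hx, rfl⟩ _ ⟨y, hy, rfl⟩
      rw [hinv hx, hinv hy, dist_eq_norm, dist_eq_norm, hsub]
      simpa using h.norm_sub_le hn hx hy
    have := hL.euclideanHausdorffMeasure_image_le d
    rwa [hinv.image_image] at this

theorem volume_eq_lintegral_slices {n : Eucl C} (hn : ‖n‖ = 1) {W : Set (Eucl C)}
    (hW : MeasurableSet W) :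
    volume W = ∫⁻ s : ℝ, (μHE[C - 1] : Measure (Eucl C)) (W ∩ {z | inner ℝ n z = s}) := by
  have hn0 : n ≠ 0 := by rintro rfl; simp at hn
  have h := EuclideanGeometry.euclideanHausdorffMeasure_eq_lintegral (0 : Eucl C) hn0 hW
  rw [InnerProductSpace.euclideanHausdorffMeasure_eq_volume, finrank_euclideanSpace_fin,
    ← ofReal_norm, hn, ENNReal.ofReal_one, one_mul] at h
  rw [h]
  congr with s
  congr 2 with z
  rw [SetLike.mem_coe, AffineSubspace.mem_mk', Submodule.mem_orthogonal_singleton_iff_inner_right]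
  simp [inner_sub_right, real_inner_smul_right, hn, sub_eq_zero]

theorem flatten_image_slice {n : Eucl C} (hn : ‖n‖ = 1) (B : Set (Eucl C × ℝ)) (s : ℝ) :
    flatten n '' B ∩ {z | inner ℝ n z = s} =
      (fun x => flatten n (x, s)) '' {x | (x, s) ∈ B} := by
  ext z
  constructor
  · rintro ⟨⟨⟨x, r⟩, hq, rfl⟩, hz⟩
    have hz' : r = s := (inner_flatten hn (x, r)).symm.trans hz
    subst hz'
    exact ⟨x, hq, rfl⟩
  · rintro ⟨x, hx, rfl⟩
    exact ⟨⟨(x, s), hx, rfl⟩, inner_flatten hn (x, s)⟩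

theorem IsFlat.measurableSet_flatten_image {n : Eucl C} (hn : ‖n‖ = 1) {δ : NNReal}
    {A : Set (Eucl C)} (h : IsFlat n δ A) {B : Set (Eucl C × ℝ)} (hB : MeasurableSet B)
    (hBA : B ⊆ A ×ˢ univ) : MeasurableSet (flatten n '' B) :=
  hB.image_of_continuousOn_injOn (continuous_flatten n).continuousOn
    ((h.injOn_flatten hn).mono hBA)

/-- Flattening changes the measure `dS ds` over a `δ`-flat hypersurface by a factor between `1` and
`(1 + δ)^(C-1)`. -/
theorem IsFlat.volume_flatten_image {n : Eucl C} (hn : ‖n‖ = 1) {δ : NNReal}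
    {A : Set (Eucl C)} (h : IsFlat n δ A) {ν : Measure (Eucl C)} [SFinite ν]
    (hν : ∀ D ⊆ A, MeasurableSet D → ν D = (μHE[C - 1] : Measure (Eucl C)) D)
    {B : Set (Eucl C × ℝ)} (hB : MeasurableSet B) (hBA : B ⊆ A ×ˢ univ) :
    volume (flatten n '' B) ≤ (ν.prod volume) B ∧
      (ν.prod volume) B ≤ ((1 + δ : NNReal) : ENNReal) ^ (C - 1) * volume (flatten n '' B) := by
  have hD : ∀ s : ℝ, {x | (x, s) ∈ B} ⊆ A := fun s x hx => (hBA hx).1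
  have hDm : ∀ s : ℝ, MeasurableSet {x | (x, s) ∈ B} := fun s => measurable_prodMk_right hB
  have e : (ν.prod volume) B =
      ∫⁻ s : ℝ, (μHE[C - 1] : Measure (Eucl C)) {x | (x, s) ∈ B} := by
    rw [Measure.prod_apply_symm hB]
    exact lintegral_congr fun s => hν _ (hD s) (hDm s)
  rw [volume_eq_lintegral_slices hn (h.measurableSet_flatten_image hn hB hBA), e]
  simp_rw [flatten_image_slice hn]
  have key := fun s => (h.mono (hD s)).euclideanHausdorffMeasure_image hn (C - 1) s
  refine ⟨lintegral_mono fun s => (key s).1, ?_⟩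
  rw [← lintegral_const_mul' _ _ (by finiteness)]
  exact lintegral_mono fun s => (key s).2

/-- A cylinder over a set of vanishing surface measure has vanishing volume. -/
theorem volume_cylinder_eq_zero {v : Eucl C} (hv : v ≠ 0) {N : Set (Eucl C)}
    (hN : (μHE[C - 1] : Measure (Eucl C)) N = 0) :
    volume {z : Eucl C | ∃ y ∈ N, ∃ s : ℝ, z = y + s • v} = 0 := by
  set n : Eucl C := ‖v‖⁻¹ • v with hndef
  have hn : ‖n‖ = 1 := norm_smul_inv_norm hv
  have hPN : (μHE[C - 1] : Measure (Eucl C)) (tangentPart n '' N) = 0 := by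
    have hL : LipschitzOnWith 1 (tangentPart n) N := by
      refine LipschitzOnWith.of_dist_le_mul fun x _ y _ => ?_
      rw [dist_eq_norm, dist_eq_norm, ← map_sub, NNReal.coe_one, one_mul]
      exact norm_tangentPart_le hn _
    exact le_antisymm ((hL.euclideanHausdorffMeasure_image_le (C - 1)).trans (by simp [hN]))
      (by simp)
  set M := toMeasurable (μHE[C - 1] : Measure (Eucl C)) (tangentPart n '' N) with hM
  have hM0 : (μHE[C - 1] : Measure (Eucl C)) M = 0 := by rw [hM, measure_toMeasurable, hPN]
  have hvn : v = ‖v‖ • n := by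
    rw [hndef, smul_smul, mul_inv_cancel₀ (norm_ne_zero_iff.2 hv), one_smul]
  have hvt : tangentPart n v = 0 := by rw [hvn, map_smul, tangentPart_self hn, smul_zero]
  refine measure_mono_null (t := tangentPart n ⁻¹' M) ?_ ?_
  · rintro z ⟨y, hy, s, rfl⟩
    rw [mem_preimage, map_add, map_smul, hvt, smul_zero, add_zero]
    exact subset_toMeasurable _ _ (mem_image_of_mem _ hy)
  · rw [volume_eq_lintegral_slices hn
      ((tangentPart n).continuous.measurable (measurableSet_toMeasurable _ _))]
    refine (lintegral_congr fun s => ?_).trans lintegral_zero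
    refine measure_mono_null (t := (fun y => (- (s • n)) + y) ⁻¹' M) ?_ ?_
    · rintro z ⟨hz, hs⟩
      rw [mem_preimage, tangentPart_apply, show inner ℝ n z = s from hs] at hz
      rw [mem_preimage, neg_add_eq_sub]
      exact hz
    · rw [measure_preimage_add, hM0]

end Flatten

/-! ### Local structure of the surface measure -/

section Surface

variable {C : ℕ} {Ω : Set (Eucl C)}

theorem exists_isFlat (hΩo : IsOpen Ω) {x₀ : Eucl C} (hx : x₀ ∈ regularBoundary Ω) {δ : NNReal}
    (hδ : 0 < δ) : ∃ U, IsOpen U ∧ x₀ ∈ U ∧ IsFlat (outwardNormal Ω x₀) δ (U ∩ frontier Ω) := by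
  have hδ' : (0 : ℝ) < δ := hδ
  obtain ⟨V, hV, h⟩ := eventually_abs_inner_sub_le hΩo hx (δ := δ / (1 + δ)) (by positivity)
  obtain ⟨U, hUV, hU, hxU⟩ := mem_nhds_iff.1 hV
  refine ⟨U, hU, hxU, fun x hx' y hy' => ?_⟩
  have h1 := h x ⟨hUV hx'.1, hx'.2⟩ y ⟨hUV hy'.1, hy'.2⟩
  have h2 := norm_le_norm_tangentPart_add (isOutwardUnitNormal_outwardNormal hx).norm_eq_one (x - y)
  rw [div_mul_eq_mul_div, le_div_iff₀ (by positivity)] at h1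
  nlinarith

theorem surfaceMeasure_apply {D : Set (Eucl C)} (hD : D ⊆ frontier Ω) :
    surfaceMeasure Ω D = (μHE[C - 1] : Measure (Eucl C)) D := by
  rw [surfaceMeasure, Measure.restrict_apply' isClosed_frontier.measurableSet,
    inter_eq_left.2 hD]

theorem surfaceMeasure_compl_regularBoundary (hG : HasAEC1Boundary Ω) :
    surfaceMeasure Ω (regularBoundary Ω)ᶜ = 0 := hG

theorem IsFlat.euclideanHausdorffMeasure_lt_top {n : Eucl C} (hn : ‖n‖ = 1) {δ : NNReal}
    {D : Set (Eucl C)} (h : IsFlat n δ D) (hD : MeasurableSet D) (hb : Bornology.IsBounded D) :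
    (μHE[C - 1] : Measure (Eucl C)) D < ⊤ := by
  have hB : MeasurableSet (D ×ˢ Icc (0 : ℝ) 1) := hD.prod measurableSet_Icc
  have hW : volume (flatten n '' (D ×ˢ Icc (0 : ℝ) 1)) < ⊤ := by
    have hc : IsCompact (closure D ×ˢ Icc (0 : ℝ) 1) := hb.isCompact_closure.prod isCompact_Icc
    exact (measure_mono (image_mono (Set.prod_mono subset_closure Subset.rfl))).trans_lt
      (hc.image (continuous_flatten n)).measure_lt_top
  have hle : (μHE[C - 1] : Measure (Eucl C)) D ≤
      ((1 + δ : NNReal) : ENNReal) ^ (C - 1) * volume (flatten n '' (D ×ˢ Icc (0 : ℝ) 1)) := by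
    rw [volume_eq_lintegral_slices hn
      (h.measurableSet_flatten_image hn hB (Set.prod_mono Subset.rfl (subset_univ _))),
      ← lintegral_const_mul' _ _ (by finiteness)]
    calc (μHE[C - 1] : Measure (Eucl C)) D
        = ∫⁻ _ in Icc (0 : ℝ) 1, (μHE[C - 1] : Measure (Eucl C)) D := by simp
      _ ≤ ∫⁻ s in Icc (0 : ℝ) 1, ((1 + δ : NNReal) : ENNReal) ^ (C - 1) *
            (μHE[C - 1] : Measure (Eucl C)) (flatten n '' (D ×ˢ Icc (0 : ℝ) 1) ∩
              {z | inner ℝ n z = s}) := by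
          refine setLIntegral_mono' measurableSet_Icc fun s hs => ?_
          rw [flatten_image_slice hn]
          have e : {x | (x, s) ∈ D ×ˢ Icc (0 : ℝ) 1} = D := by ext x; simp [hs.1, hs.2]
          rw [e]
          exact (h.euclideanHausdorffMeasure_image hn (C - 1) s).2
      _ ≤ _ := setLIntegral_le_lintegral _ _
  exact hle.trans_lt (by finiteness)

/-- The regular part of the boundary is covered by countably many bounded flat pieces, which have
finite surface measure, and the rest is a null set. -/
theorem sigmaFinite_surfaceMeasure (hΩo : IsOpen Ω) (hG : HasAEC1Boundary Ω) :
    SigmaFinite (surfaceMeasure Ω) := by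
  have h1 : ∀ x ∈ regularBoundary Ω, ∃ U, U ∈ 𝓝 x ∧ surfaceMeasure Ω U < ⊤ := by
    intro x hx
    obtain ⟨U, hU, hxU, hF⟩ := exists_isFlat hΩo hx one_pos
    refine ⟨U ∩ Metric.ball x 1, inter_mem (hU.mem_nhds hxU) (Metric.ball_mem_nhds x one_pos), ?_⟩
    rw [surfaceMeasure, Measure.restrict_apply' isClosed_frontier.measurableSet]
    refine IsFlat.euclideanHausdorffMeasure_lt_top
      (isOutwardUnitNormal_outwardNormal hx).norm_eq_one (hF.mono ?_)
      ((hU.measurableSet.inter measurableSet_ball).inter isClosed_frontier.measurableSet)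
      (Metric.isBounded_ball.subset (inter_subset_left.trans inter_subset_right))
    exact fun y hy => ⟨hy.1.1, hy.2⟩
  choose! U hU hfin using h1
  obtain ⟨t, ht, htc, hcov⟩ := TopologicalSpace.countable_cover_nhdsWithin
    fun x hx => mem_nhdsWithin_of_mem_nhds (hU x hx)
  refine Measure.sigmaFinite_of_countable (S := U '' t ∪ {(regularBoundary Ω)ᶜ})
    ((htc.image U).union (countable_singleton _)) ?_ ?_
  · rintro s (⟨x, hx, rfl⟩ | rfl)
    · exact hfin x (ht hx)
    · rw [surfaceMeasure_compl_regularBoundary hG]; exact ENNReal.zero_lt_top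
  · refine eq_univ_of_forall fun x => ?_
    by_cases hx : x ∈ regularBoundary Ω
    · obtain ⟨y, hy, hxy⟩ := mem_iUnion₂.1 (hcov hx)
      exact ⟨U y, Or.inl ⟨y, hy, rfl⟩, hxy⟩
    · exact ⟨_, Or.inr rfl, hx⟩

/-- A set of `σ`-finite `(C - 1)`-dimensional measure has vanishing `C`-dimensional measure. -/
theorem volume_frontier_eq_zero (hC : 1 ≤ C) (hΩo : IsOpen Ω) (hG : HasAEC1Boundary Ω) :
    volume (frontier Ω) = 0 := by
  have := sigmaFinite_surfaceMeasure hΩo hG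
  have h : frontier Ω = ⋃ i, spanningSets (surfaceMeasure Ω) i ∩ frontier Ω := by
    rw [← iUnion_inter, iUnion_spanningSets, univ_inter]
  rw [h, measure_iUnion_null_iff]
  intro i
  have h1 : (μHE[C - 1] : Measure (Eucl C))
      (spanningSets (surfaceMeasure Ω) i ∩ frontier Ω) < ⊤ := by
    rw [← surfaceMeasure_apply inter_subset_right]
    exact (measure_mono inter_subset_left).trans_lt (measure_spanningSets_lt_top _ i)
  have h2 := (Measure.euclideanHausdorffMeasure_zero_or_top (show C - 1 < C by omega)
    (spanningSets (surfaceMeasure Ω) i ∩ frontier Ω)).resolve_right h1.ne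
  have h3 : (μHE[C] : Measure (Eucl C)) = volume :=
    EuclideanSpace.euclideanHausdorffMeasure_eq_volume C
  rwa [h3] at h2

end Surface

/-! ### The area formula for free flight from the boundary -/

section Area

variable {C : ℕ} {Ω : Set (Eucl C)}

/-- The point from which a particle of velocity `v` started if it is at `x` after time `s`. -/
def retrace (v : Eucl C) (q : Eucl C × ℝ) : Eucl C := q.1 - q.2 • v

theorem continuous_retrace (v : Eucl C) : Continuous (retrace v) := by
  unfold retrace; fun_prop

/-- The linear map `P x + s n ↦ P x - s v`. -/
def shearTo (n v : Eucl C) : Eucl C →L[ℝ] Eucl C :=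
  tangentPart n - (innerSL ℝ n).smulRight v

theorem abs_det_shearTo {n : Eucl C} (hn : ‖n‖ = 1) (v : Eucl C) :
    |(shearTo n v).det| = |inner ℝ v n| := by
  have h : ((shearTo n v : Eucl C →L[ℝ] Eucl C) : Eucl C →ₗ[ℝ] Eucl C) =
      LinearMap.transvection ((innerSL ℝ n : Eucl C →L[ℝ] ℝ) : Eucl C →ₗ[ℝ] ℝ) (-(n + v)) := by
    ext1 x
    simp [shearTo, tangentPart_apply, LinearMap.transvection.apply, smul_add]
    abel
  rw [ContinuousLinearMap.det, h, LinearMap.transvection.det]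
  have e : (1 : ℝ) + inner ℝ n (-(n + v)) = - inner ℝ v n := by
    rw [inner_neg_right, inner_add_right, real_inner_self_eq_norm_sq, hn, real_inner_comm]; ring
  have e' : (1 : ℝ) + ((innerSL ℝ n : Eucl C →L[ℝ] ℝ) : Eucl C →ₗ[ℝ] ℝ) (-(n + v)) =
      - inner ℝ v n := e
  rw [e', abs_neg]

/-- Over a `δ`-flat hypersurface, `P x + s n ↦ x - s v` is `δ`-close to a linear map. -/
theorem IsFlat.exists_approximatesLinearOn {n : Eucl C} (hn : ‖n‖ = 1) (v : Eucl C) {δ : NNReal}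
    {A : Set (Eucl C)} (h : IsFlat n δ A) {B : Set (Eucl C × ℝ)} (hBA : B ⊆ A ×ˢ univ) :
    ∃ T : Eucl C → Eucl C, ApproximatesLinearOn T (shearTo n v) (flatten n '' B) δ ∧
      T '' (flatten n '' B) = retrace v '' B := by
  have hinv := ((h.injOn_flatten hn).mono hBA).leftInvOn_invFunOn
  refine ⟨fun z => retrace v (Function.invFunOn (flatten n) B z), ?_, ?_⟩
  · rintro _ ⟨q, hq, rfl⟩ _ ⟨r, hr, rfl⟩
    simp only [hinv hq, hinv hr]
    have e1 : tangentPart n (flatten n q - flatten n r) = tangentPart n (q.1 - r.1) := by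
      rw [map_sub, tangentPart_flatten hn, tangentPart_flatten hn, map_sub]
    have e2 : retrace v q - retrace v r - shearTo n v (flatten n q - flatten n r) =
        inner ℝ n (q.1 - r.1) • n := by
      have : shearTo n v (flatten n q - flatten n r) =
          tangentPart n (flatten n q - flatten n r) -
            inner ℝ n (flatten n q - flatten n r) • v := by
        simp [shearTo]
      rw [this, e1, inner_sub_right, inner_flatten hn, inner_flatten hn, tangentPart_apply,
        retrace, retrace, sub_smul]
      abel
    rw [e2, norm_smul, hn, mul_one, Real.norm_eq_abs]
    refine (h _ (hBA hq).1 _ (hBA hr).1).trans ?_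
    rw [← e1]
    exact mul_le_mul_of_nonneg_left (norm_tangentPart_le hn _) δ.2
  · rw [image_image]
    exact image_congr fun q hq => by rw [hinv hq]

/-- The flux density `|v · n|` of particles of velocity `v` through the boundary. -/
def flux (Ω : Set (Eucl C)) (v x : Eucl C) : ENNReal :=
  ENNReal.ofReal |inner ℝ v (outwardNormal Ω x)|

theorem measurable_flux (hΩo : IsOpen Ω) (v : Eucl C) : Measurable (flux Ω v) := by
  have := measurable_outwardNormal hΩo
  unfold flux
  fun_prop

/-- For small `δ`, the distortion `(1 + δ)ᵈ` of surface measure and the variation `δ a` of the flux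
density `c` are absorbed in an error `ε`. -/
theorem eventually_flux_pinching (c a : ℝ) (d : ℕ) {ε : ℝ} (hε : 0 < ε) :
    ∀ᶠ δ : NNReal in 𝓝[>] 0, (c + δ * a) * (1 + δ) ^ d < c + ε := by
  have h : Continuous fun δ : NNReal => (c + δ * a) * (1 + (δ : ℝ)) ^ d := by fun_prop
  have h0 := h.tendsto 0
  simp only [NNReal.coe_zero, zero_mul, add_zero, one_pow, mul_one] at h0
  exact (h0.mono_left nhdsWithin_le_nhds).eventually (gt_mem_nhds (by linarith))

/-- The two-sided area estimate holds, up to an error `ε`, on all pieces of `A × ℝ`. -/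
def HasAreaEstimate (Ω : Set (Eucl C)) (v : Eucl C) (ε : NNReal) (A : Set (Eucl C)) : Prop :=
  ∀ B : Set (Eucl C × ℝ), MeasurableSet B → B ⊆ (A ∩ frontier Ω) ×ˢ univ →
    volume (retrace v '' B) ≤
        ∫⁻ q in B, (flux Ω v q.1 + ε) ∂((surfaceMeasure Ω).prod volume) ∧
      ∫⁻ q in B, flux Ω v q.1 ∂((surfaceMeasure Ω).prod volume) ≤
        volume (retrace v '' B) + ε * ((surfaceMeasure Ω).prod volume) B

theorem exists_hasAreaEstimate (hΩo : IsOpen Ω) [SFinite (surfaceMeasure Ω)] (v : Eucl C)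
    {ε : NNReal} (hε : 0 < ε) {x₀ : Eucl C} (hx : x₀ ∈ regularBoundary Ω) :
    ∃ U, IsOpen U ∧ x₀ ∈ U ∧ HasAreaEstimate Ω v ε U := by
  have hε' : (0 : ℝ) < ε := hε
  set n := outwardNormal Ω x₀ with hndef
  have hn : ‖n‖ = 1 := (isOutwardUnitNormal_outwardNormal hx).norm_eq_one
  set c : ℝ := |inner ℝ v n| with hc
  have hc0 : 0 ≤ c := abs_nonneg _
  set m₁ : NNReal := ⟨c + ε / 2, by positivity⟩ with hm₁
  set m₂ : NNReal := (c - ε / 2).toNNReal with hm₂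
  have hm₁' : (m₁ : ENNReal) = ENNReal.ofReal (c + ε / 2) :=
    (ENNReal.ofReal_eq_coe_nnreal _).symm
  have h1 := addHaar_image_le_mul_of_det_lt (volume : Measure (Eucl C)) (shearTo n v) (m := m₁) (by
    rw [abs_det_shearTo hn, hm₁']
    exact (ENNReal.ofReal_lt_ofReal_iff (by positivity)).2 (by linarith))
  -- if `c ≤ ε / 2` then `m₂ = 0`, and the lower bound is trivial; this covers the tangential case,
  -- where the linear map is not invertible
  have h2 : ∀ᶠ δ in 𝓝[>] (0 : NNReal), ∀ (s : Set (Eucl C)) (f : Eucl C → Eucl C),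
      ApproximatesLinearOn f (shearTo n v) s δ → (m₂ : ENNReal) * volume s ≤ volume (f '' s) := by
    rcases le_or_gt (c - ε / 2) 0 with h0 | h0
    · have : m₂ = 0 := Real.toNNReal_of_nonpos h0
      simp [this]
    · refine mul_le_addHaar_image_of_lt_det (volume : Measure (Eucl C)) (shearTo n v) ?_
      rw [abs_det_shearTo hn, hm₂]
      exact (ENNReal.ofReal_lt_ofReal_iff (by linarith)).2 (by linarith)
  have h3 := eventually_flux_pinching c ‖v‖ (C - 1) (half_pos hε')
  obtain ⟨δ, ⟨h1, h2, h3⟩, hδ⟩ := ((h1.and (h2.and h3)).and self_mem_nhdsWithin).exists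
  have hδ' : (0 : ℝ) < δ := hδ
  have h4 : (δ : ℝ) * ‖v‖ < ε / 2 := by
    have : 1 ≤ (1 + (δ : ℝ)) ^ (C - 1) := one_le_pow₀ (by linarith)
    nlinarith [mul_nonneg hδ'.le (norm_nonneg v)]
  obtain ⟨U, hU, hxU, hF⟩ := exists_isFlat hΩo hx hδ
  -- near `x₀` the normal is close to the normal at `x₀`
  have h5 : ∀ᶠ y in 𝓝 x₀, y ∈ frontier Ω → ‖outwardNormal Ω y - n‖ < δ := by
    have hcont := continuousOn_outwardNormal hΩo x₀ ⟨regularBoundary_subset_frontier hx, hx⟩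
    have := (Metric.tendsto_nhds.1 hcont) δ hδ'
    rw [eventually_nhdsWithin_iff] at this
    filter_upwards [this, eventually_mem_regularBoundary hΩo hx] with y hy hy' hyf
    rw [← dist_eq_norm]
    exact hy ⟨hyf, hy' hyf⟩
  obtain ⟨V, hVs, hV, hxV⟩ := mem_nhds_iff.1 h5
  refine ⟨U ∩ V, hU.inter hV, ⟨hxU, hxV⟩, fun B hB hBA => ?_⟩
  have hBA' : B ⊆ (U ∩ frontier Ω) ×ˢ univ :=
    fun q hq => ⟨⟨(hBA hq).1.1.1, (hBA hq).1.2⟩, trivial⟩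
  have hflux : ∀ q ∈ B, |(|inner ℝ v (outwardNormal Ω q.1)| - c)| ≤ δ * ‖v‖ := by
    intro q hq
    have hq5 : ‖outwardNormal Ω q.1 - n‖ < δ := hVs (hBA hq).1.1.2 (hBA hq).1.2
    refine (abs_abs_sub_abs_le_abs_sub _ _).trans ?_
    rw [← inner_sub_right]
    refine (abs_real_inner_le_norm _ _).trans ?_
    rw [mul_comm]
    exact mul_le_mul_of_nonneg_right hq5.le (norm_nonneg v)
  obtain ⟨hV1, hV2⟩ := hF.volume_flatten_image hn (ν := surfaceMeasure Ω)
    (fun D hD _ => surfaceMeasure_apply (hD.trans inter_subset_right)) hB hBA'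
  obtain ⟨T, hT, hTi⟩ := hF.exists_approximatesLinearOn hn v hBA'
  have hX1 := h1 _ _ hT
  have hX2 := h2 _ _ hT
  rw [hTi] at hX1 hX2
  constructor
  · calc volume (retrace v '' B) ≤ m₁ * volume (flatten n '' B) := hX1
      _ ≤ m₁ * ((surfaceMeasure Ω).prod volume) B := by gcongr
      _ = ∫⁻ _ in B, m₁ ∂((surfaceMeasure Ω).prod volume) := by rw [setLIntegral_const]
      _ ≤ _ := by
        refine setLIntegral_mono' hB fun q hq => ?_
        rw [hm₁', flux, ← ENNReal.ofReal_coe_nnreal,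
          ← ENNReal.ofReal_add (abs_nonneg _) ε.coe_nonneg]
        refine ENNReal.ofReal_le_ofReal ?_
        linarith [(abs_le.1 (hflux q hq)).1]
  · calc ∫⁻ q in B, flux Ω v q.1 ∂((surfaceMeasure Ω).prod volume)
        ≤ ∫⁻ _ in B, ENNReal.ofReal (c + δ * ‖v‖) ∂((surfaceMeasure Ω).prod volume) := by
          refine setLIntegral_mono' hB fun q hq => ENNReal.ofReal_le_ofReal ?_
          linarith [(abs_le.1 (hflux q hq)).2]
      _ = ENNReal.ofReal (c + δ * ‖v‖) * ((surfaceMeasure Ω).prod volume) B := by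
          rw [setLIntegral_const]
      _ ≤ ENNReal.ofReal (c + δ * ‖v‖) *
            (((1 + δ : NNReal) : ENNReal) ^ (C - 1) * volume (flatten n '' B)) := by gcongr
      _ = ENNReal.ofReal ((c + δ * ‖v‖) * (1 + δ) ^ (C - 1)) * volume (flatten n '' B) := by
          rw [← mul_assoc, ENNReal.ofReal_mul (by positivity), ENNReal.ofReal_pow (by positivity)]
          congr 3
          rw [← ENNReal.ofReal_coe_nnreal]; simp
      _ ≤ ((m₂ : ENNReal) + ε) * volume (flatten n '' B) := by
          gcongr
          rw [← ENNReal.ofReal_coe_nnreal, ← ENNReal.ofReal_coe_nnreal (p := ε),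
            ← ENNReal.ofReal_add m₂.coe_nonneg ε.coe_nonneg]
          refine ENNReal.ofReal_le_ofReal ?_
          have : c - ε / 2 ≤ (m₂ : ℝ) := Real.le_coe_toNNReal _
          linarith
      _ ≤ volume (retrace v '' B) + ε * ((surfaceMeasure Ω).prod volume) B := by
          rw [add_mul]
          gcongr

/-- A local property that passes to subsets holds on the pieces of a countable measurable
partition. -/
theorem exists_measurable_partition {X : Type*} [TopologicalSpace X] [SecondCountableTopology X]
    [MeasurableSpace X] [BorelSpace X] {s : Set X} {P : Set X → Prop} (h0 : P ∅)
    (hmono : ∀ A B, A ⊆ B → P B → P A) (h : ∀ x ∈ s, ∃ U, IsOpen U ∧ x ∈ U ∧ P U) :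
    ∃ A : ℕ → Set X, (∀ i, MeasurableSet (A i)) ∧ Pairwise (Function.onFun Disjoint A) ∧
      s ⊆ ⋃ i, A i ∧ ∀ i, P (A i) := by
  rcases s.eq_empty_or_nonempty with rfl | hs
  · exact ⟨fun _ => ∅, fun _ => .empty, fun _ _ _ => disjoint_bot_left, empty_subset _, fun _ => h0⟩
  choose! U hU hxU hP using h
  obtain ⟨t, hts, htc, hcov⟩ := TopologicalSpace.countable_cover_nhdsWithin
    fun x hx => mem_nhdsWithin_of_mem_nhds ((hU x hx).mem_nhds (hxU x hx))
  have htn : t.Nonempty := by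
    obtain ⟨x, hx⟩ := hs
    obtain ⟨y, hy, -⟩ := mem_iUnion₂.1 (hcov hx)
    exact ⟨y, hy⟩
  obtain ⟨g, rfl⟩ := htc.exists_eq_range htn
  refine ⟨disjointed fun i => U (g i),
    fun i => .disjointed (fun j => (hU _ (hts ⟨j, rfl⟩)).measurableSet) i,
    disjoint_disjointed _, ?_, fun i => hmono _ _ (disjointed_subset _ i) (hP _ (hts ⟨i, rfl⟩))⟩
  rw [iUnion_disjointed]
  simpa using hcov

theorem volume_retrace_iUnion_le {ν : Measure (Eucl C × ℝ)} (v : Eucl C) (g : Eucl C × ℝ → ENNReal)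
    {B : ℕ → Set (Eucl C × ℝ)} (hB : ∀ i, MeasurableSet (B i))
    (hd : Pairwise (Function.onFun Disjoint B))
    (h : ∀ i, volume (retrace v '' B i) ≤ ∫⁻ q in B i, g q ∂ν) :
    volume (retrace v '' ⋃ i, B i) ≤ ∫⁻ q in ⋃ i, B i, g q ∂ν := by
  rw [image_iUnion, lintegral_iUnion hB hd]
  exact (measure_iUnion_le _).trans (ENNReal.tsum_le_tsum h)

theorem lintegral_iUnion_le_volume_retrace {ν : Measure (Eucl C × ℝ)} (v : Eucl C)
    (g : Eucl C × ℝ → ENNReal) (ε : ENNReal) {B : ℕ → Set (Eucl C × ℝ)}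
    (hB : ∀ i, MeasurableSet (B i)) (hd : Pairwise (Function.onFun Disjoint B))
    (hinj : InjOn (retrace v) (⋃ i, B i))
    (h : ∀ i, ∫⁻ q in B i, g q ∂ν ≤ volume (retrace v '' B i) + ε * ν (B i)) :
    ∫⁻ q in ⋃ i, B i, g q ∂ν ≤ volume (retrace v '' ⋃ i, B i) + ε * ν (⋃ i, B i) := by
  rw [lintegral_iUnion hB hd, image_iUnion, measure_iUnion hd hB, measure_iUnion,
    ← ENNReal.tsum_mul_left, ← ENNReal.tsum_add]
  · exact ENNReal.tsum_le_tsum h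
  · intro i j hij
    refine Set.disjoint_left.2 ?_
    rintro _ ⟨q, hq, rfl⟩ ⟨r, hr, he⟩
    have := hinj (mem_iUnion.2 ⟨j, hr⟩) (mem_iUnion.2 ⟨i, hq⟩) he
    subst this
    exact Set.disjoint_left.1 (hd hij) hq hr
  · intro i
    exact (hB i).image_of_continuousOn_injOn (continuous_retrace v).continuousOn
      (hinj.mono (subset_iUnion B i))

theorem le_of_forall_le_add_mul {a b r : ENNReal} (hr : r ≠ ⊤)
    (h : ∀ ε : NNReal, 0 < ε → a ≤ b + ε * r) : a ≤ b := by
  have h1 : Tendsto (fun ε : NNReal => b + ε * r) (𝓝[>] 0) (𝓝 (b + 0 * r)) := by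
    refine tendsto_const_nhds.add (ENNReal.Tendsto.mul_const ?_ (Or.inr hr))
    exact ENNReal.tendsto_coe.2 (tendsto_id.mono_left nhdsWithin_le_nhds)
  rw [zero_mul, add_zero] at h1
  exact ge_of_tendsto h1 (eventually_nhdsWithin_of_forall h)

theorem HasAreaEstimate.empty (v : Eucl C) (ε : NNReal) : HasAreaEstimate Ω v ε ∅ := by
  intro B _ hB
  have : B = ∅ := by simpa using hB
  simp [this]

/-- On pieces of finite measure: cut the boundary into countably many pieces on which the area
estimate holds with error `ε`, and let `ε` tend to zero. -/
theorem area_of_finite (hΩo : IsOpen Ω) [SFinite (surfaceMeasure Ω)] (v : Eucl C)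
    {B : Set (Eucl C × ℝ)} (hB : MeasurableSet B) (hBr : B ⊆ regularBoundary Ω ×ˢ univ)
    (hfin : ((surfaceMeasure Ω).prod volume) B ≠ ⊤) :
    volume (retrace v '' B) ≤ ∫⁻ q in B, flux Ω v q.1 ∂((surfaceMeasure Ω).prod volume) ∧
      (InjOn (retrace v) B →
        ∫⁻ q in B, flux Ω v q.1 ∂((surfaceMeasure Ω).prod volume) ≤ volume (retrace v '' B)) := by
  have key : ∀ ε : NNReal, 0 < ε →
      volume (retrace v '' B) ≤ ∫⁻ q in B, flux Ω v q.1 ∂((surfaceMeasure Ω).prod volume) +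
          ε * ((surfaceMeasure Ω).prod volume) B ∧
      (InjOn (retrace v) B →
        ∫⁻ q in B, flux Ω v q.1 ∂((surfaceMeasure Ω).prod volume) ≤ volume (retrace v '' B) +
          ε * ((surfaceMeasure Ω).prod volume) B) := by
    intro ε hε
    obtain ⟨A, hAm, hAd, hcov, hA⟩ := exists_measurable_partition (P := HasAreaEstimate Ω v ε)
      (HasAreaEstimate.empty v ε)
      (fun A A' hAA' h B hB hBA => h B hB
        (hBA.trans (Set.prod_mono (inter_subset_inter_left _ hAA') Subset.rfl)))
      (fun x hx => exists_hasAreaEstimate hΩo v hε hx)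
    have hBi : B = ⋃ i, B ∩ A i ×ˢ univ := by
      refine Subset.antisymm (fun q hq => ?_) (iUnion_subset fun i => inter_subset_left)
      obtain ⟨i, hi⟩ := mem_iUnion.1 (hcov (hBr hq).1)
      exact mem_iUnion.2 ⟨i, hq, hi, trivial⟩
    have hBm : ∀ i, MeasurableSet (B ∩ A i ×ˢ univ) := fun i => hB.inter ((hAm i).prod .univ)
    have hBd : Pairwise (Function.onFun Disjoint fun i => B ∩ A i ×ˢ univ) := by
      intro i j hij
      refine Set.disjoint_left.2 fun q hq hq' => ?_
      exact Set.disjoint_left.1 (hAd hij) hq.2.1 hq'.2.1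
    have hloc := fun i => hA i (B ∩ A i ×ˢ univ) (hBm i)
      (fun q hq => ⟨⟨hq.2.1, regularBoundary_subset_frontier (hBr hq.1).1⟩, trivial⟩)
    constructor
    · have := volume_retrace_iUnion_le v _ hBm hBd fun i => (hloc i).1
      rw [← hBi, lintegral_add_right _ measurable_const, setLIntegral_const] at this
      exact this
    · intro hinj
      have := lintegral_iUnion_le_volume_retrace v _ ε hBm hBd (by rwa [← hBi]) fun i => (hloc i).2
      rwa [← hBi] at this
  exact ⟨le_of_forall_le_add_mul hfin fun ε hε => (key ε hε).1,
    fun hinj => le_of_forall_le_add_mul hfin fun ε hε => (key ε hε).2 hinj⟩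

theorem volume_retrace_le_and_le (hΩo : IsOpen Ω) [SigmaFinite (surfaceMeasure Ω)] (v : Eucl C)
    {B : Set (Eucl C × ℝ)} (hB : MeasurableSet B) (hBr : B ⊆ regularBoundary Ω ×ˢ univ) :
    volume (retrace v '' B) ≤ ∫⁻ q in B, flux Ω v q.1 ∂((surfaceMeasure Ω).prod volume) ∧
      (InjOn (retrace v) B →
        ∫⁻ q in B, flux Ω v q.1 ∂((surfaceMeasure Ω).prod volume) ≤ volume (retrace v '' B)) := by
  set ρ := (surfaceMeasure Ω).prod (volume : Measure ℝ) with hρ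
  set S := disjointed (spanningSets ρ) with hS
  have hSm : ∀ i, MeasurableSet (S i) := fun i => .disjointed (measurableSet_spanningSets ρ) i
  have hBi : B = ⋃ i, B ∩ S i := by
    rw [← inter_iUnion, hS, iUnion_disjointed, iUnion_spanningSets, inter_univ]
  have hBm : ∀ i, MeasurableSet (B ∩ S i) := fun i => hB.inter (hSm i)
  have hBd : Pairwise (Function.onFun Disjoint fun i => B ∩ S i) := by
    intro i j hij
    exact (disjoint_disjointed (spanningSets ρ) hij).mono inter_subset_right inter_subset_right
  have hloc := fun i => area_of_finite hΩo v (hBm i) (inter_subset_left.trans hBr)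
    (((measure_mono (inter_subset_right.trans (disjointed_subset _ i))).trans_lt
      (measure_spanningSets_lt_top ρ i)).ne)
  constructor
  · have := volume_retrace_iUnion_le v _ hBm hBd fun i => (hloc i).1
    rwa [← hBi] at this
  · intro hinj
    have := lintegral_iUnion_le_volume_retrace (ν := ρ) v (fun q => flux Ω v q.1) 0 hBm hBd
      (by rwa [← hBi]) fun i => by
        simpa using (hloc i).2 (hinj.mono inter_subset_left)
    rw [← hBi] at this
    simpa using this

/-- **Area formula**: the region swept by particles of velocity `v` that reach the boundary at `x`
after time `s`, `(x, s) ∈ B`, has volume `∫_B |v · n| dS ds`. -/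
theorem volume_retrace_image (hΩo : IsOpen Ω) [SigmaFinite (surfaceMeasure Ω)] (v : Eucl C)
    {B : Set (Eucl C × ℝ)} (hB : MeasurableSet B) (hBr : B ⊆ regularBoundary Ω ×ˢ univ)
    (hinj : InjOn (retrace v) B) :
    volume (retrace v '' B) = ∫⁻ q in B, flux Ω v q.1 ∂((surfaceMeasure Ω).prod volume) :=
  le_antisymm (volume_retrace_le_and_le hΩo v hB hBr).1
    ((volume_retrace_le_and_le hΩo v hB hBr).2 hinj)

end Area

/-! ### Trajectories in `Ω` and their exit from it -/

section Trajectories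

variable {C : ℕ} {Ω : Set (Eucl C)}

/-- The states whose free flight stays in `Ω` up to time `t`. -/
def survivors (Ω : Set (Eucl C)) (t : ℝ) : Set (Eucl C × Eucl C) :=
  {p | ∀ r ∈ Icc 0 t, p.1 + r • p.2 ∈ Ω}

/-- The states and times `((x, v), s)` such that `x - r v ∈ Ω` for `0 < r < s`. -/
def freeBackward (Ω : Set (Eucl C)) : Set ((Eucl C × Eucl C) × ℝ) :=
  {q | 0 < q.2 ∧ ∀ r ∈ Ioo 0 q.2, q.1.1 - r • q.1.2 ∈ Ω}

/-- The triples `((x, v), s)` such that a particle starting in `Ω` with velocity `v` first meets the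
boundary at time `s ≤ t`, at the regular point `x`. -/
def arrivals (Ω : Set (Eucl C)) (t : ℝ) : Set ((Eucl C × Eucl C) × ℝ) :=
  {q | q.1.1 ∈ regularBoundary Ω ∧ q.2 ≤ t ∧ q ∈ freeBackward Ω ∧ q.1.1 - q.2 • q.1.2 ∈ Ω}

theorem mem_of_mem_arrivals {t : ℝ} {q : (Eucl C × Eucl C) × ℝ} (hq : q ∈ arrivals Ω t) {r : ℝ}
    (hr : r ∈ Ioc 0 q.2) : q.1.1 - r • q.1.2 ∈ Ω := by
  rcases hr.2.lt_or_eq with h | h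
  · exact hq.2.2.1.2 r ⟨hr.1, h⟩
  · rw [h]; exact hq.2.2.2

theorem isOpen_survivors (hΩo : IsOpen Ω) (t : ℝ) : IsOpen (survivors Ω t) := by
  refine isOpen_iff_mem_nhds.2 fun p hp => ?_
  refine isCompact_Icc.eventually_forall_of_forall_eventually
    (P := fun (p : Eucl C × Eucl C) (r : ℝ) => p.1 + r • p.2 ∈ Ω) fun r hr => ?_
  have hc : Continuous fun z : (Eucl C × Eucl C) × ℝ => z.1.1 + z.2 • z.1.2 := by fun_prop
  exact hc.continuousAt.preimage_mem_nhds (hΩo.mem_nhds (hp r hr))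

theorem measurableSet_freeBackward (hΩo : IsOpen Ω) : MeasurableSet (freeBackward Ω) := by
  have hσ : IsSigmaCompact (Ioo (0 : ℝ) 1) := by
    have : LocallyCompactSpace (Ioo (0 : ℝ) 1) := isOpen_Ioo.locallyCompactSpace
    exact isSigmaCompact_iff_sigmaCompactSpace.2 inferInstance
  obtain ⟨K, hK, hKu⟩ := hσ
  have hopen : ∀ i, IsOpen {q : (Eucl C × Eucl C) × ℝ |
      ∀ θ ∈ K i, q.1.1 - (θ * q.2) • q.1.2 ∈ Ω} := by
    intro i
    refine isOpen_iff_mem_nhds.2 fun q hq => ?_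
    refine (hK i).eventually_forall_of_forall_eventually
      (P := fun (q : (Eucl C × Eucl C) × ℝ) (θ : ℝ) => q.1.1 - (θ * q.2) • q.1.2 ∈ Ω) fun θ hθ => ?_
    have hc : Continuous fun z : ((Eucl C × Eucl C) × ℝ) × ℝ =>
        z.1.1.1 - (z.2 * z.1.2) • z.1.1.2 := by fun_prop
    exact hc.continuousAt.preimage_mem_nhds (hΩo.mem_nhds (hq θ hθ))
  have e : freeBackward Ω = {q | 0 < q.2} ∩ ⋂ i, {q : (Eucl C × Eucl C) × ℝ |
      ∀ θ ∈ K i, q.1.1 - (θ * q.2) • q.1.2 ∈ Ω} := by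
    ext q
    simp only [freeBackward, mem_ofPred_eq, mem_inter_iff, mem_iInter]
    refine and_congr_right fun hq => ⟨fun h i θ hθ => ?_, fun h r hr => ?_⟩
    · have hθ' : θ ∈ Ioo (0 : ℝ) 1 := hKu ▸ mem_iUnion.2 ⟨i, hθ⟩
      exact h _ ⟨mul_pos hθ'.1 hq, by nlinarith [hθ'.2]⟩
    · have hθ : r / q.2 ∈ Ioo (0 : ℝ) 1 := ⟨div_pos hr.1 hq, (div_lt_one hq).2 hr.2⟩
      rw [← hKu] at hθ
      obtain ⟨i, hi⟩ := mem_iUnion.1 hθ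
      have := h i _ hi
      rwa [div_mul_cancel₀ _ hq.ne'] at this
  rw [e]
  exact (measurable_snd measurableSet_Ioi).inter (.iInter fun i => (hopen i).measurableSet)

theorem measurableSet_arrivals (hΩo : IsOpen Ω) (t : ℝ) : MeasurableSet (arrivals Ω t) := by
  have hc : Continuous fun q : (Eucl C × Eucl C) × ℝ => q.1.1 - q.2 • q.1.2 := by fun_prop
  exact ((measurable_fst.comp measurable_fst) (measurableSet_regularBoundary hΩo)).inter
    ((measurable_snd measurableSet_Iic).inter
      ((measurableSet_freeBackward hΩo).inter (hc.measurable hΩo.measurableSet)))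

/-- A ray from `x ∈ Ω` that leaves `Ω` has a first exit point, and this point is on `∂Ω`. -/
theorem exists_first_exit (hΩo : IsOpen Ω) {x w : Eucl C} {s : ℝ} (hx : x ∈ Ω) (hs : 0 ≤ s)
    (hxs : x + s • w ∉ Ω) :
    ∃ r, 0 < r ∧ r ≤ s ∧ x + r • w ∈ frontier Ω ∧ ∀ r' ∈ Ico 0 r, x + r' • w ∈ Ω := by
  have hc : Continuous fun r : ℝ => x + r • w := by fun_prop
  have hK : IsCompact (Icc 0 s ∩ (fun r : ℝ => x + r • w) ⁻¹' Ωᶜ) :=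
    isCompact_Icc.inter_right (hΩo.isClosed_compl.preimage hc)
  obtain ⟨r, ⟨hr, hrΩ⟩, hmin⟩ := hK.exists_isLeast ⟨s, ⟨hs, le_rfl⟩, hxs⟩
  have hr0 : 0 < r := by
    refine lt_of_le_of_ne hr.1 ?_
    rintro rfl
    exact hrΩ (by simpa using hx)
  have hbefore : ∀ r' ∈ Ico 0 r, x + r' • w ∈ Ω := by
    intro r' hr'
    by_contra hcon
    exact absurd (hmin ⟨⟨hr'.1, hr'.2.le.trans hr.2⟩, hcon⟩) (not_le.2 hr'.2)
  refine ⟨r, hr0, hr.2, ?_, hbefore⟩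
  rw [hΩo.frontier_eq]
  refine ⟨mem_closure_of_tendsto ((hc.tendsto r).mono_left nhdsWithin_le_nhds :
    Tendsto _ (𝓝[<] r) _) ?_, hrΩ⟩
  filter_upwards [Ioo_mem_nhdsLT hr0] with r' hr'
  exact hbefore r' ⟨hr'.1.le, hr'.2⟩

theorem notMem_of_mem_frontier (hΩo : IsOpen Ω) {x : Eucl C} (hx : x ∈ frontier Ω) : x ∉ Ω := by
  rw [hΩo.frontier_eq] at hx
  exact hx.2

theorem injOn_retrace_arrivals (hΩo : IsOpen Ω) (v : Eucl C) (t : ℝ) :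
    InjOn (retrace v) {q | ((q.1, v), q.2) ∈ arrivals Ω t} := by
  have key : ∀ q r : Eucl C × ℝ, ((q.1, v), q.2) ∈ arrivals Ω t → ((r.1, v), r.2) ∈ arrivals Ω t →
      retrace v q = retrace v r → ¬ q.2 < r.2 := by
    intro q r hq hr he hlt
    have h1 : r.1 - (r.2 - q.2) • v ∈ Ω :=
      mem_of_mem_arrivals hr (r := r.2 - q.2) ⟨by simpa using hlt, by simpa using hq.2.2.1.1.le⟩
    have h2 : r.1 - (r.2 - q.2) • v = q.1 := by
      have : q.1 - q.2 • v = r.1 - r.2 • v := he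
      rw [sub_smul, ← sub_add, ← this, sub_add_cancel]
    rw [h2] at h1
    exact notMem_of_mem_frontier hΩo (regularBoundary_subset_frontier hq.1) h1
  intro q hq r hr he
  have h2 : q.2 = r.2 :=
    le_antisymm (not_lt.1 (key r q hr hq he.symm)) (not_lt.1 (key q r hq hr he))
  have h1 : q.1 - q.2 • v = r.1 - r.2 • v := he
  rw [h2, sub_left_inj] at h1
  exact Prod.ext h1 h2

/-! ### Lines that meet the boundary tangentially or at singular points -/

/-- The points on lines of direction `v` that meet `∂Ω` at a point which is not regular, or
tangentially. -/
def badLines (Ω : Set (Eucl C)) (v : Eucl C) : Set (Eucl C) :=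
  {z | ∃ y ∈ frontier Ω, (y ∉ regularBoundary Ω ∨ inner ℝ v (outwardNormal Ω y) = 0) ∧
    ∃ s : ℝ, z = y + s • v}

theorem add_smul_mem_badLines {v z : Eucl C} (r : ℝ) (hz : z ∈ badLines Ω v) :
    z + r • v ∈ badLines Ω v := by
  obtain ⟨y, hy, hy', s, rfl⟩ := hz
  exact ⟨y, hy, hy', s + r, by rw [add_smul, add_assoc]⟩

theorem sub_smul_mem_badLines {v z : Eucl C} (r : ℝ) (hz : z ∈ badLines Ω v) :
    z - r • v ∈ badLines Ω v := by
  rw [sub_eq_add_neg, ← neg_smul]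
  exact add_smul_mem_badLines _ hz

theorem mem_badLines_self {v y : Eucl C} (hy : y ∈ frontier Ω)
    (h : y ∉ regularBoundary Ω ∨ inner ℝ v (outwardNormal Ω y) = 0) : y ∈ badLines Ω v :=
  ⟨y, hy, h, 0, by simp⟩

/-- Almost no line meets the boundary tangentially (by the area formula, where the flux vanishes) or
at a singular point (by projection along `v`). -/
theorem volume_badLines (hΩo : IsOpen Ω) (hG : HasAEC1Boundary Ω) {v : Eucl C} (hv : v ≠ 0) :
    volume (badLines Ω v) = 0 := by
  have := sigmaFinite_surfaceMeasure hΩo hG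
  have h1 : volume {z : Eucl C | ∃ y ∈ frontier Ω \ regularBoundary Ω, ∃ s : ℝ, z = y + s • v} =
      0 := by
    refine volume_cylinder_eq_zero hv ?_
    rw [← surfaceMeasure_apply sdiff_subset]
    exact measure_mono_null (fun x hx => hx.2) (surfaceMeasure_compl_regularBoundary hG)
  set B : Set (Eucl C × ℝ) :=
    (regularBoundary Ω ∩ {y | inner ℝ v (outwardNormal Ω y) = 0}) ×ˢ univ with hBdef
  have hB : MeasurableSet B := by
    refine ((measurableSet_regularBoundary hΩo).inter ?_).prod .univ
    have := measurable_outwardNormal hΩo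
    exact measurableSet_eq_fun (by fun_prop) measurable_const
  have h2 : volume (retrace v '' B) = 0 := by
    have h3 := (volume_retrace_le_and_le hΩo v hB
      (Set.prod_mono inter_subset_left Subset.rfl)).1
    have h4 : ∫⁻ q in B, flux Ω v q.1 ∂((surfaceMeasure Ω).prod volume) = 0 := by
      rw [setLIntegral_congr_fun hB (g := fun _ => 0) (fun q hq => ?_), lintegral_zero]
      have : inner ℝ v (outwardNormal Ω q.1) = 0 := hq.1.2
      simp [flux, this]
    rw [h4] at h3
    simpa using h3
  refine measure_mono_null ?_ (measure_union_null h1 h2)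
  rintro z ⟨y, hy, hy', s, rfl⟩
  by_cases hyr : y ∈ regularBoundary Ω
  · exact Or.inr ⟨(y, -s), ⟨⟨hyr, hy'.resolve_left (not_not.2 hyr)⟩, trivial⟩, by simp [retrace]⟩
  · exact Or.inl ⟨y, ⟨hy, hyr⟩, s, rfl⟩

/-- For fixed velocity, the region from which particles arrive by time `t` is, up to a null set, the
part of `Ω` which they leave by time `t`. -/
theorem retrace_image_arrivals (hΩo : IsOpen Ω) (hG : HasAEC1Boundary Ω) {v : Eucl C} (hv : v ≠ 0)
    (t : ℝ) :
    (retrace v '' {q | ((q.1, v), q.2) ∈ arrivals Ω t} : Set (Eucl C)) =ᵐ[volume]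
      {z | z ∈ Ω ∧ (z, v) ∉ survivors Ω t} := by
  have hn : ∀ᵐ z : Eucl C, z ∉ badLines Ω v :=
    measure_eq_zero_iff_ae_notMem.1 (volume_badLines hΩo hG hv)
  filter_upwards [hn] with z hz
  refine propext ⟨?_, ?_⟩
  · rintro ⟨q, hq, rfl⟩
    refine ⟨hq.2.2.2, fun h => ?_⟩
    have := h q.2 ⟨hq.2.2.1.1.le, hq.2.1⟩
    simp only [retrace, sub_add_cancel] at this
    exact notMem_of_mem_frontier hΩo (regularBoundary_subset_frontier hq.1) this
  · rintro ⟨hzΩ, hzs⟩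
    simp only [survivors, mem_ofPred_eq, not_forall] at hzs
    obtain ⟨r, hr, hrΩ⟩ := hzs
    obtain ⟨s, hs0, hsr, hsf, hbefore⟩ := exists_first_exit hΩo hzΩ hr.1 hrΩ
    refine ⟨(z + s • v, s), ⟨?_, hsr.trans hr.2, ⟨hs0, fun r' hr' => ?_⟩, ?_⟩, ?_⟩
    · by_contra hreg
      refine hz ?_
      have := sub_smul_mem_badLines s (mem_badLines_self (v := v) hsf (Or.inl hreg))
      rwa [add_sub_cancel_right] at this
    · have := hbefore (s - r') ⟨sub_nonneg.2 hr'.2.le, by linarith [hr'.1]⟩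
      rwa [sub_smul, ← add_sub_assoc] at this
    · simpa using hzΩ
    · simp [retrace]

end Trajectories

/-! ### Solutions along trajectories -/

section Solution

variable {C : ℕ} {Ω : Set (Eucl C)} {f fG : Eucl C → Eucl C → ℝ → ℝ}

/-- Along a segment in `Ω`, the vanishing directional derivative makes the density constant. -/
theorem IsStickingTransportSolution.const_along (h : IsStickingTransportSolution Ω f fG)
    {x v : Eucl C} {t s : ℝ} (ht : 0 ≤ t) (hs : 0 ≤ s) (hx : ∀ r ∈ Icc 0 s, x + r • v ∈ Ω) :
    f (x + s • v) v (t + s) = f x v t := by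
  set g : ℝ → ℝ := fun r => f (x + r • v) v (t + r) with hg
  have hd : ∀ r ∈ Icc 0 s, HasDerivWithinAt g 0 (Icc 0 s) r := by
    intro r hr
    have h1 := h.transport (x + r • v) (hx r hr) v (t + r) (add_nonneg ht hr.1)
    rw [HasLineDerivWithinAt] at h1
    have h2 : HasDerivWithinAt (fun τ : ℝ => τ - r) 1 (Icc 0 s) r :=
      ((hasDerivAt_id r).sub_const r).hasDerivWithinAt
    have h3 := HasDerivWithinAt.scomp_of_eq (t' := _) r h1 h2 (fun τ hτ => ?_) (sub_self r).symm
    · rw [smul_zero] at h3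
      refine h3.congr_of_eventuallyEq_of_mem (Eventually.of_forall fun τ => ?_) hr
      simp only [hg, Function.comp, Prod.fst_add, Prod.snd_add, Prod.smul_fst, Prod.smul_snd,
        smul_zero, add_zero, smul_eq_mul, mul_one]
      congr 1
      · rw [add_assoc, ← add_smul, add_sub_cancel]
      · ring
    · refine ⟨?_, trivial, ?_⟩
      · have := hx τ hτ
        simpa [add_assoc, ← add_smul] using this
      · have : 0 ≤ t + τ := add_nonneg ht hτ.1
        simpa using this
  have h4 := constant_of_has_deriv_right_zero (f := g) (a := 0) (b := s)
    (fun r hr => (hd r hr).continuousWithinAt)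
    (fun r hr => ((hd r ⟨hr.1, hr.2.le⟩).mono_of_mem_nhdsWithin (Icc_mem_nhdsGE_of_mem hr)))
    s ⟨hs, le_rfl⟩
  simpa [hg] using h4

/-- Constancy along trajectories, read backwards in time. -/
theorem IsStickingTransportSolution.eq_retrace (h : IsStickingTransportSolution Ω f fG)
    {x v : Eucl C} {t r : ℝ} (hr : 0 ≤ r) (hrt : r ≤ t) (hx : ∀ r' ∈ Icc 0 r, x - r' • v ∈ Ω) :
    f x v t = f (x - r • v) v (t - r) := by
  have := h.const_along (x := x - r • v) (v := v) (sub_nonneg.2 hrt) hr (fun r' hr' => by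
    have := hx (r - r') ⟨sub_nonneg.2 hr'.2, by linarith [hr'.1]⟩
    rwa [sub_smul, ← sub_add] at this)
  simpa using this

/-- There are no particles on trajectories that come from the boundary: their density is the limit
at the boundary point, where no particle enters. -/
theorem IsStickingTransportSolution.eq_zero_of_exit
    (h : IsStickingTransportSolution Ω f fG) {x v : Eucl C} {t r : ℝ} (hr : 0 < r) (hrt : r < t)
    (hx : ∀ r' ∈ Ico 0 r, x - r' • v ∈ Ω) (hf : x - r • v ∈ frontier Ω) (hb : x ∉ badLines Ω v) :
    f x v t = 0 := by
  set y := x - r • v with hy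
  have hb' : y ∉ badLines Ω v := fun hyb => hb (by
    have := add_smul_mem_badLines r hyb
    rwa [hy, sub_add_cancel] at this)
  have hyreg : y ∈ regularBoundary Ω := by
    by_contra hc; exact hb' (mem_badLines_self hf (Or.inl hc))
  have hy0 : inner ℝ v (outwardNormal Ω y) ≠ 0 := fun hc => hb' (mem_badLines_self hf (Or.inr hc))
  have hin : ∀ ρ ∈ Ioc 0 r, y + ρ • v ∈ Ω := by
    intro ρ hρ
    have := hx (r - ρ) ⟨sub_nonneg.2 hρ.2, by linarith [hρ.1]⟩
    rwa [sub_smul, ← sub_add] at this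
  have hev : ∀ᶠ ρ : ℝ in 𝓝[>] 0, ρ ∈ Ioc 0 r := Ioc_mem_nhdsGT hr
  -- `v` cannot point outwards at `y`, since the trajectory enters `Ω` there
  have hneg : inner ℝ v (outwardNormal Ω y) < 0 := by
    refine lt_of_le_of_ne (not_lt.1 fun hpos => ?_) hy0
    rw [real_inner_comm] at hpos
    have h1 := (isOutwardUnitNormal_outwardNormal hyreg).eventually_notMem hpos
    obtain ⟨ρ, h2, h3⟩ := (h1.and hev).exists
    exact h2 (hin ρ h3)
  have hτ : 0 < t - r := sub_pos.2 hrt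
  have hlim := h.incoming_trace y hf v hneg (t - r) hτ
  rw [h.no_inflow y hf v hneg (t - r) hτ] at hlim
  refine tendsto_nhds_unique (tendsto_const_nhds.congr' ?_) hlim
  filter_upwards [hev] with ρ hρ
  have h1 := h.eq_retrace (x := x) (v := v) (t := t) (r := r - ρ) (sub_nonneg.2 hρ.2)
    (by linarith [hρ.1]) (fun r' hr' => hx r' ⟨hr'.1, by linarith [hr'.2, hρ.1]⟩)
  rw [h1, hy, sub_smul, ← sub_add]
  congr 1
  ring

/-- Outside exceptional lines, the interior density at time `t` is the initial density of the
particles that have stayed in `Ω`. -/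
theorem IsStickingTransportSolution.interior_eq (hΩo : IsOpen Ω)
    (h : IsStickingTransportSolution Ω f fG) {x v : Eucl C} {t : ℝ} (ht : 0 ≤ t)
    (hb : x ∉ badLines Ω v) (hfr : x - t • v ∉ frontier Ω) :
    (Ω ×ˢ univ).indicator (fun p : Eucl C × Eucl C => f p.1 p.2 t) (x, v) =
      (survivors Ω t).indicator (fun p => f p.1 p.2 0) (freeFlightFlow (-t) (x, v)) := by
  have hflow : freeFlightFlow (-t) (x, v) = (x - t • v, v) := by
    simp [freeFlightFlow, sub_eq_add_neg]
  rw [hflow]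
  by_cases hs : (x - t • v, v) ∈ survivors Ω t
  · have hs' : ∀ r ∈ Icc 0 t, x - r • v ∈ Ω := by
      intro r hr
      have := hs (t - r) ⟨sub_nonneg.2 hr.2, by linarith [hr.1]⟩
      simpa [sub_smul] using this
    have hxΩ : x ∈ Ω := by simpa using hs' 0 ⟨le_rfl, ht⟩
    rw [indicator_of_mem hs, indicator_of_mem (show (x, v) ∈ Ω ×ˢ univ from ⟨hxΩ, trivial⟩)]
    simpa using h.eq_retrace ht le_rfl hs'
  · rw [indicator_of_notMem hs]
    by_cases hxΩ : x ∈ Ω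
    · rw [indicator_of_mem (show (x, v) ∈ Ω ×ˢ univ from ⟨hxΩ, trivial⟩)]
      simp only [survivors, mem_ofPred_eq, not_forall] at hs
      obtain ⟨r, hr, hrΩ⟩ := hs
      have hrΩ' : x + (t - r) • (-v) ∉ Ω := by
        have e : x + (t - r) • (-v) = x - t • v + r • v := by module
        rwa [e]
      obtain ⟨s, hs0, hsr, hsf, hbefore⟩ := exists_first_exit hΩo hxΩ (sub_nonneg.2 hr.2) hrΩ'
      simp only [smul_neg, ← sub_eq_add_neg] at hsf hbefore
      have hst : s < t := by
        refine lt_of_le_of_ne (hsr.trans (by linarith [hr.1])) ?_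
        rintro rfl
        exact hfr hsf
      exact h.eq_zero_of_exit hs0 hst hbefore hsf hb
    · rw [indicator_of_notMem]
      exact fun hc => hxΩ hc.1

/-- Outside exceptional lines and exit times, the flux into the boundary at time `s` is carried by
the particles that arrive at time `s` from `Ω`. -/
theorem IsStickingTransportSolution.boundary_eq (hΩo : IsOpen Ω)
    (h : IsStickingTransportSolution Ω f fG) {x v : Eucl C} {s t : ℝ} (hs : 0 < s) (hst : s ≤ t)
    (hx : x ∈ regularBoundary Ω) (hb : 0 < inner ℝ v (outwardNormal Ω x) → x ∉ badLines Ω v)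
    (hexit : ((x, v), s) ∈ freeBackward Ω → x - s • v ∈ Ω) :
    max (inner ℝ v (outwardNormal Ω x)) 0 * f x v s =
      |inner ℝ v (outwardNormal Ω x)| *
        (arrivals Ω t).indicator (fun q => f (q.1.1 - q.2 • q.1.2) q.1.2 0) ((x, v), s) := by
  have hxf := regularBoundary_subset_frontier hx
  rcases lt_trichotomy (inner ℝ v (outwardNormal Ω x)) 0 with hneg | h0 | hpos
  · have hnot : ((x, v), s) ∉ arrivals Ω t := by
      intro hq
      have hw : 0 < inner ℝ (outwardNormal Ω x) (-v) := by
        rw [inner_neg_right, real_inner_comm]; linarith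
      obtain ⟨r, h1, h2⟩ := (((isOutwardUnitNormal_outwardNormal hx).eventually_notMem hw).and
        (Ioc_mem_nhdsGT hs)).exists
      rw [smul_neg, ← sub_eq_add_neg] at h1
      exact h1 (mem_of_mem_arrivals hq h2)
    rw [indicator_of_notMem hnot, max_eq_right hneg.le]; simp
  · simp [h0]
  rw [max_eq_left hpos.le, abs_of_pos hpos]
  congr 1
  have hb' := hb hpos
  have hlim := h.outgoing_trace x hxf v hpos s hs
  have hw : inner ℝ (outwardNormal Ω x) (-v) < 0 := by
    rw [inner_neg_right, real_inner_comm]; linarith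
  have hnear := (isOutwardUnitNormal_outwardNormal hx).eventually_mem hw
  by_cases hq : ((x, v), s) ∈ arrivals Ω t
  · rw [indicator_of_mem hq]
    refine tendsto_nhds_unique hlim (tendsto_const_nhds.congr' ?_)
    filter_upwards [Ioc_mem_nhdsGT hs] with r hr
    have h1 := h.eq_retrace (x := x - r • v) (v := v) (t := s - r) (r := s - r)
      (sub_nonneg.2 hr.2) le_rfl (fun r' hr' => by
        have := mem_of_mem_arrivals hq (r := r + r')
          ⟨by linarith [hr.1, hr'.1], by simp only; linarith [hr'.2]⟩
        simpa [add_smul, sub_sub] using this)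
    rw [h1, sub_self, sub_smul, sub_sub, add_sub_cancel]
  · rw [indicator_of_notMem hq]
    -- the trajectory arriving at `x` left the boundary at some time in `(0, s)`
    have hex : ∃ r₀, 0 < r₀ ∧ r₀ < s ∧ x - r₀ • v ∈ frontier Ω ∧
        ∀ r ∈ Ioo 0 r₀, x - r • v ∈ Ω := by
      have hmiss : ∃ r₁ ∈ Ioc 0 s, x - r₁ • v ∉ Ω := by
        by_contra hc
        push Not at hc
        exact hq ⟨hx, hst, ⟨hs, fun r hr => hc r ⟨hr.1, hr.2.le⟩⟩, hc s ⟨hs, le_rfl⟩⟩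
      obtain ⟨r₁, hr₁, hr₁Ω⟩ := hmiss
      obtain ⟨η, hη0, hη⟩ := mem_nhdsGT_iff_exists_Ioc_subset.1 hnear
      have hη0' : (0 : ℝ) < η := hη0
      have hηΩ : ∀ r ∈ Ioc 0 η, x - r • v ∈ Ω := by
        intro r hr
        have : x + r • (-v) ∈ Ω := hη hr
        rwa [smul_neg, ← sub_eq_add_neg] at this
      have hηr : η < r₁ := by
        by_contra hc
        exact hr₁Ω (hηΩ r₁ ⟨hr₁.1, not_lt.1 hc⟩)
      obtain ⟨r, hr0, hrle, hrf, hbefore⟩ := exists_first_exit hΩo (x := x - η • v) (w := -v)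
        (s := r₁ - η) (hηΩ η ⟨hη0', le_rfl⟩) (sub_nonneg.2 hηr.le) (by
          rwa [smul_neg, ← sub_eq_add_neg, sub_sub, ← add_smul, add_sub_cancel])
      simp only [smul_neg, ← sub_eq_add_neg, sub_sub, ← add_smul] at hrf hbefore
      have hall : ∀ ρ ∈ Ioo 0 (η + r), x - ρ • v ∈ Ω := by
        intro ρ hρ
        rcases le_or_gt ρ η with hle | hgt
        · exact hηΩ ρ ⟨hρ.1, hle⟩
        · have := hbefore (ρ - η) ⟨sub_nonneg.2 hgt.le, by linarith [hρ.2]⟩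
          rwa [add_sub_cancel] at this
      refine ⟨η + r, by linarith, lt_of_le_of_ne (by linarith [hr₁.2]) ?_, hrf, hall⟩
      intro he
      rw [he] at hall hrf
      exact notMem_of_mem_frontier hΩo hrf (hexit ⟨hs, hall⟩)
    obtain ⟨r₀, hr₀, hr₀s, hf₀, hall⟩ := hex
    refine tendsto_nhds_unique hlim (tendsto_const_nhds.congr' ?_)
    filter_upwards [Ioo_mem_nhdsGT hr₀] with r hr
    symm
    refine h.eq_zero_of_exit (r := r₀ - r) (sub_pos.2 hr.2) (by linarith) (fun r' hr' => ?_) ?_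
      (fun hc => hb' ?_)
    · rw [sub_sub, ← add_smul]
      exact hall _ ⟨by linarith [hr.1, hr'.1], by linarith [hr'.2]⟩
    · rwa [sub_sub, ← add_smul, add_sub_cancel]
    · have := add_smul_mem_badLines r hc
      rwa [sub_add_cancel] at this

end Solution

/-! ### Mass arriving at the boundary -/

section Mass

variable {C : ℕ} {Ω : Set (Eucl C)} {f fG : Eucl C → Eucl C → ℝ → ℝ}

/-- The exceptional lines also meet the surface in a null set, away from tangency. Otherwise
the particles that arrive at these points shortly after time `0` would come from a set of positive
volume. -/
theorem ae_notMem_badLines (hΩo : IsOpen Ω) (hG : HasAEC1Boundary Ω) {v : Eucl C} (hv : v ≠ 0) :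
    ∀ᵐ x ∂(surfaceMeasure Ω), x ∈ regularBoundary Ω → 0 < inner ℝ v (outwardNormal Ω x) →
      x ∉ badLines Ω v := by
  have := sigmaFinite_surfaceMeasure hΩo hG
  set M := toMeasurable volume (badLines Ω v) with hM
  have hM0 : volume M = 0 := by rw [hM, measure_toMeasurable, volume_badLines hΩo hG hv]
  set A : Set (Eucl C × ℝ) :=
    {q | ((q.1, v), q.2) ∈ arrivals Ω 1} ∩ retrace v ⁻¹' M with hA
  have hAm : MeasurableSet A := by
    refine MeasurableSet.inter ?_
      ((continuous_retrace v).measurable (measurableSet_toMeasurable _ _))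
    have : Measurable fun q : Eucl C × ℝ => ((q.1, v), q.2) := by fun_prop
    exact this (measurableSet_arrivals hΩo 1)
  have h1 := volume_retrace_image hΩo v hAm (fun q hq => ⟨hq.1.1, trivial⟩)
    ((injOn_retrace_arrivals hΩo v 1).mono inter_subset_left)
  rw [measure_mono_null (image_subset_iff.2 inter_subset_right) hM0] at h1
  have h1' := (setLIntegral_eq_zero_iff hAm
    (show Measurable fun q : Eucl C × ℝ => flux Ω v q.1 from
      (measurable_flux hΩo v).comp measurable_fst)).1 h1.symm
  filter_upwards [Measure.ae_ae_of_ae_prod h1'] with x hx hxr hpos hxb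
  have hw : inner ℝ (outwardNormal Ω x) (-v) < 0 := by
    rw [inner_neg_right, real_inner_comm]; linarith
  have hnear := (isOutwardUnitNormal_outwardNormal hxr).eventually_mem hw
  obtain ⟨η, hη0, hη⟩ := mem_nhdsGT_iff_exists_Ioc_subset.1 hnear
  have hη0' : (0 : ℝ) < η := hη0
  have hηΩ : ∀ r ∈ Ioc 0 η, x - r • v ∈ Ω := by
    intro r hr
    have : x + r • (-v) ∈ Ω := hη hr
    rwa [smul_neg, ← sub_eq_add_neg] at this
  have hne : flux Ω v x ≠ 0 := by
    rw [flux, Ne, ENNReal.ofReal_eq_zero, not_le, abs_of_pos hpos]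
    exact hpos
  have h2 : volume (Ioc 0 (min η 1)) = 0 := by
    refine measure_mono_null (fun s hs => ?_) hx
    have hs1 : s ≤ η := hs.2.trans (min_le_left _ _)
    refine fun hc => hne (hc ⟨⟨hxr, hs.2.trans (min_le_right _ _), ⟨hs.1, fun r hr => ?_⟩, ?_⟩, ?_⟩)
    · exact hηΩ r ⟨hr.1, hr.2.le.trans hs1⟩
    · exact hηΩ s ⟨hs.1, hs1⟩
    · exact subset_toMeasurable _ _ (sub_smul_mem_badLines s hxb)
  rw [Real.volume_Ioc, ENNReal.ofReal_eq_zero] at h2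
  have : 0 < min η 1 := lt_min hη0' one_pos
  linarith

/-- For each trajectory there is at most one time at which it starts from the boundary. -/
theorem ae_freeBackward (hΩo : IsOpen Ω) (hG : HasAEC1Boundary Ω) (v : Eucl C) :
    ∀ᵐ q : Eucl C × ℝ ∂((surfaceMeasure Ω).prod volume),
      ((q.1, v), q.2) ∈ freeBackward Ω → q.1 - q.2 • v ∈ Ω := by
  have := sigmaFinite_surfaceMeasure hΩo hG
  have hm1 : Measurable fun q : Eucl C × ℝ => ((q.1, v), q.2) := by fun_prop
  have hN : MeasurableSet {q : Eucl C × ℝ | ((q.1, v), q.2) ∈ freeBackward Ω ∧ q.1 - q.2 • v ∉ Ω} :=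
    (hm1 (measurableSet_freeBackward hΩo)).inter
      ((continuous_retrace v).measurable hΩo.measurableSet.compl)
  have h0 : ((surfaceMeasure Ω).prod volume)
      {q : Eucl C × ℝ | ((q.1, v), q.2) ∈ freeBackward Ω ∧ q.1 - q.2 • v ∉ Ω} = 0 := by
    refine (Measure.measure_prod_null hN).2 (Eventually.of_forall fun x => ?_)
    refine Set.Subsingleton.measure_zero (fun s hs r hr => ?_) _
    by_contra hne
    rcases lt_or_gt_of_ne hne with h | h
    · exact hs.2 (hr.1.2 s ⟨hs.1.1, h⟩)
    · exact hr.2 (hs.1.2 r ⟨hr.1.1, h⟩)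
  filter_upwards [measure_eq_zero_iff_ae_notMem.1 h0] with q hq h1
  by_contra h2
  exact hq ⟨h1, h2⟩

/-- Integration over the boundary, velocity and time, with the velocity integral outermost. -/
theorem lintegral_surface_velocity_time [SFinite (surfaceMeasure Ω)]
    {F : (Eucl C × Eucl C) × ℝ → ENNReal} (hF : Measurable F) :
    ∫⁻ q, F q ∂(((surfaceMeasure Ω).prod volume).prod volume) =
      ∫⁻ v : Eucl C, ∫⁻ q : Eucl C × ℝ, F ((q.1, v), q.2) ∂((surfaceMeasure Ω).prod volume) := by
  rw [lintegral_prod _ hF.aemeasurable,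
    lintegral_prod _ hF.lintegral_prod_right'.aemeasurable, lintegral_lintegral_swap]
  · refine lintegral_congr fun v => ?_
    have hm : Measurable fun q : Eucl C × ℝ => F ((q.1, v), q.2) := by fun_prop
    rw [lintegral_prod _ hm.aemeasurable]
  · exact hF.lintegral_prod_right'.aemeasurable

theorem ae_velocity_ne_zero (hC : 1 ≤ C) : ∀ᵐ v : Eucl C, v ≠ 0 := by
  have : Nonempty (Fin C) := ⟨⟨0, hC⟩⟩
  exact measure_eq_zero_iff_ae_notMem.1 (measure_singleton (0 : Eucl C))

theorem ae_surface_velocity_time (hC : 1 ≤ C) [SFinite (surfaceMeasure Ω)]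
    {N : Set ((Eucl C × Eucl C) × ℝ)} (hN : MeasurableSet N)
    (h : ∀ v : Eucl C, v ≠ 0 →
      ∀ᵐ q : Eucl C × ℝ ∂((surfaceMeasure Ω).prod volume), ((q.1, v), q.2) ∈ N) :
    ∀ᵐ q ∂(((surfaceMeasure Ω).prod volume).prod volume), q ∈ N := by
  refine mem_ae_iff.2 ?_
  change (((surfaceMeasure Ω).prod volume).prod volume) Nᶜ = 0
  rw [← lintegral_indicator_one hN.compl,
    lintegral_surface_velocity_time (measurable_one.indicator hN.compl), ← lintegral_zero]
  refine lintegral_congr_ae ?_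
  filter_upwards [ae_velocity_ne_zero hC] with v hv
  rw [← lintegral_zero]
  refine lintegral_congr_ae ?_
  filter_upwards [h v hv] with q hq
  exact indicator_of_notMem (not_not.2 hq) _

theorem ae_phase (hC : 1 ≤ C) {N : Set (Eucl C × Eucl C)} (hN : MeasurableSet N)
    (h : ∀ v : Eucl C, v ≠ 0 → ∀ᵐ x : Eucl C, (x, v) ∈ N) :
    ∀ᵐ p : Eucl C × Eucl C, p ∈ N := by
  refine mem_ae_iff.2 ?_
  change volume Nᶜ = 0
  rw [Measure.volume_eq_prod, Measure.prod_apply_symm hN.compl, ← lintegral_zero]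
  refine lintegral_congr_ae ?_
  filter_upwards [ae_velocity_ne_zero hC] with v hv
  exact mem_ae_iff.1 (h v hv)

/-- The states in `Ω` whose free flight leaves `Ω` by time `t`. -/
def leavers (Ω : Set (Eucl C)) (t : ℝ) : Set (Eucl C × Eucl C) :=
  {p | p.1 ∈ Ω ∧ p ∉ survivors Ω t}

theorem measurableSet_leavers (hΩo : IsOpen Ω) (t : ℝ) : MeasurableSet (leavers Ω t) :=
  (measurable_fst hΩo.measurableSet).inter (isOpen_survivors hΩo t).measurableSet.compl

/-- The initial state of a particle that arrives at `x` with velocity `v` at time `s`. -/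
def departure (q : (Eucl C × Eucl C) × ℝ) : Eucl C × Eucl C := (q.1.1 - q.2 • q.1.2, q.1.2)

theorem measurable_departure :
    Measurable (departure : (Eucl C × Eucl C) × ℝ → Eucl C × Eucl C) := by
  unfold departure; fun_prop

theorem measurable_flux_phase (hΩo : IsOpen Ω) :
    Measurable fun q : (Eucl C × Eucl C) × ℝ => flux Ω q.1.2 q.1.1 := by
  have := measurable_outwardNormal hΩo
  unfold flux
  fun_prop

/-- The flux of arriving particles, transported to their initial states, is Lebesgue measure on the
set of particles that leave. -/
theorem map_departure (hC : 1 ≤ C) (hΩo : IsOpen Ω) (hG : HasAEC1Boundary Ω) (t : ℝ) :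
    (((((surfaceMeasure Ω).prod (volume : Measure (Eucl C))).prod (volume : Measure ℝ)).restrict
      (arrivals Ω t)).withDensity fun q => flux Ω q.1.2 q.1.1).map departure =
      volume.restrict (leavers Ω t) := by
  have := sigmaFinite_surfaceMeasure hΩo hG
  ext M hM
  have hpre : MeasurableSet (departure ⁻¹' M : Set ((Eucl C × Eucl C) × ℝ)) :=
    measurable_departure hM
  have hset := hpre.inter (measurableSet_arrivals hΩo t)
  rw [Measure.map_apply measurable_departure hM, withDensity_apply _ hpre,
    Measure.restrict_restrict hpre, ← lintegral_indicator hset,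
    lintegral_surface_velocity_time ((measurable_flux_phase hΩo).indicator hset),
    Measure.restrict_apply hM, Measure.volume_eq_prod,
    Measure.prod_apply_symm (hM.inter (measurableSet_leavers hΩo t))]
  refine lintegral_congr_ae ?_
  filter_upwards [ae_velocity_ne_zero hC] with v hv
  set B : Set (Eucl C × ℝ) := {q | ((q.1, v), q.2) ∈ arrivals Ω t} with hB
  set N : Set (Eucl C) := {z | (z, v) ∈ M} with hN
  have hm1 : Measurable fun q : Eucl C × ℝ => ((q.1, v), q.2) := by fun_prop
  have hBm : MeasurableSet B := hm1 (measurableSet_arrivals hΩo t)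
  have hNm : MeasurableSet N := measurable_prodMk_right hM
  have hBN : MeasurableSet (B ∩ retrace v ⁻¹' N) :=
    hBm.inter ((continuous_retrace v).measurable hNm)
  calc ∫⁻ q : Eucl C × ℝ, (departure ⁻¹' M ∩ arrivals Ω t).indicator
          (fun q => flux Ω q.1.2 q.1.1) ((q.1, v), q.2) ∂((surfaceMeasure Ω).prod volume)
      = ∫⁻ q in B ∩ retrace v ⁻¹' N, flux Ω v q.1 ∂((surfaceMeasure Ω).prod volume) := by
        rw [← lintegral_indicator hBN]
        refine lintegral_congr fun q => ?_
        have hiff : ((q.1, v), q.2) ∈ departure ⁻¹' M ∩ arrivals Ω t ↔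
            q ∈ B ∩ retrace v ⁻¹' N := and_comm
        by_cases hq : q ∈ B ∩ retrace v ⁻¹' N
        · rw [indicator_of_mem hq, indicator_of_mem (hiff.2 hq)]
        · rw [indicator_of_notMem hq, indicator_of_notMem (fun h => hq (hiff.1 h))]
    _ = volume (retrace v '' (B ∩ retrace v ⁻¹' N)) :=
        (volume_retrace_image hΩo v hBN (fun q hq => ⟨hq.1.1, trivial⟩)
          ((injOn_retrace_arrivals hΩo v t).mono inter_subset_left)).symm
    _ = volume {z | (z, v) ∈ M ∩ leavers Ω t} := by
        rw [image_inter_preimage, inter_comm]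
        exact measure_congr ((ae_eq_refl _).inter (retrace_image_arrivals hΩo hG hv t))

/-- The rate `(v · n)₊ f` at which particles accumulate on the boundary, up to time `t`. -/
def accumulationRate (Ω : Set (Eucl C)) (f : Eucl C → Eucl C → ℝ → ℝ) (t : ℝ)
    (q : (Eucl C × Eucl C) × ℝ) : ℝ :=
  (Ioc 0 t).indicator
    (fun s => max (inner ℝ q.1.2 (outwardNormal Ω q.1.1)) 0 * f q.1.1 q.1.2 s) q.2

theorem accumulationRate_ae_eq (hC : 1 ≤ C) (hΩo : IsOpen Ω) (hG : HasAEC1Boundary Ω)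
    (h : IsStickingTransportSolution Ω f fG) (t : ℝ) :
    accumulationRate Ω f t =ᵐ[((surfaceMeasure Ω).prod volume).prod volume]
      (arrivals Ω t).indicator fun q => (flux Ω q.1.2 q.1.1).toReal *
        f (departure q).1 (departure q).2 0 := by
  have := sigmaFinite_surfaceMeasure hΩo hG
  have hn := measurable_outwardNormal hΩo
  have hf := h.measurable
  have hm1 : Measurable (accumulationRate Ω f t) := by
    have e : accumulationRate Ω f t = (Prod.snd ⁻¹' Ioc 0 t).indicator
        fun q : (Eucl C × Eucl C) × ℝ =>
          max (inner ℝ q.1.2 (outwardNormal Ω q.1.1)) 0 * f q.1.1 q.1.2 q.2 := rfl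
    rw [e]
    refine Measurable.indicator ?_ (measurable_snd measurableSet_Ioc)
    refine Measurable.mul (by fun_prop) ?_
    exact hf.comp (g := fun q : Eucl C × Eucl C × ℝ => f q.1 q.2.1 q.2.2)
      (f := fun q : (Eucl C × Eucl C) × ℝ => (q.1.1, q.1.2, q.2)) (by fun_prop)
  have hm2 : Measurable ((arrivals Ω t).indicator fun q => (flux Ω q.1.2 q.1.1).toReal *
      f (departure q).1 (departure q).2 0) := by
    refine Measurable.indicator ?_ (measurableSet_arrivals hΩo t)
    refine (measurable_flux_phase hΩo).ennreal_toReal.mul ?_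
    exact hf.comp (g := fun q : Eucl C × Eucl C × ℝ => f q.1 q.2.1 q.2.2)
      (f := fun q : (Eucl C × Eucl C) × ℝ => ((departure q).1, (departure q).2, 0))
      (by have := measurable_departure (C := C); fun_prop)
  refine ae_surface_velocity_time hC (measurableSet_eq_fun hm1 hm2) fun v hv => ?_
  have h1 : ∀ᵐ q : Eucl C × ℝ ∂((surfaceMeasure Ω).prod volume), q.1 ∈ regularBoundary Ω ∧
      (q.1 ∈ regularBoundary Ω → 0 < inner ℝ v (outwardNormal Ω q.1) → q.1 ∉ badLines Ω v) :=
    Measure.quasiMeasurePreserving_fst.ae (hG.and (ae_notMem_badLines hΩo hG hv))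
  filter_upwards [h1, ae_freeBackward hΩo hG v] with q hq1 hq2
  change accumulationRate Ω f t ((q.1, v), q.2) = _
  by_cases hs : q.2 ∈ Ioc 0 t
  · rw [accumulationRate, indicator_of_mem hs,
      h.boundary_eq hΩo hs.1 hs.2 hq1.1 (hq1.2 hq1.1) hq2]
    by_cases hq : ((q.1, v), q.2) ∈ arrivals Ω t
    · rw [indicator_of_mem hq, indicator_of_mem hq, flux, ENNReal.toReal_ofReal (abs_nonneg _)]
      rfl
    · rw [indicator_of_notMem hq, indicator_of_notMem hq, mul_zero]
  · rw [accumulationRate, indicator_of_notMem hs, indicator_of_notMem]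
    exact fun hq => hs ⟨hq.2.2.1.1, hq.2.1⟩

theorem integrable_accumulationRate (hC : 1 ≤ C) (hΩo : IsOpen Ω) (hG : HasAEC1Boundary Ω)
    (h : IsStickingTransportSolution Ω f fG) (t : ℝ)
    (hf0 : IntegrableOn (fun p : Eucl C × Eucl C => f p.1 p.2 0) (leavers Ω t)) :
    Integrable (accumulationRate Ω f t) (((surfaceMeasure Ω).prod volume).prod volume) ∧
      ∫ q, accumulationRate Ω f t q ∂(((surfaceMeasure Ω).prod volume).prod volume) =
        ∫ p in leavers Ω t, f p.1 p.2 0 := by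
  have hae := accumulationRate_ae_eq hC hΩo hG h t
  have hA := measurableSet_arrivals hΩo t
  have hJ := measurable_flux_phase hΩo
  have hJt : ∀ᵐ q ∂((((surfaceMeasure Ω).prod (volume : Measure (Eucl C))).prod
      (volume : Measure ℝ)).restrict (arrivals Ω t)), flux Ω q.1.2 q.1.1 < ⊤ :=
    Eventually.of_forall fun q => ENNReal.ofReal_lt_top
  rw [IntegrableOn, ← map_departure hC hΩo hG t] at hf0
  rw [integrable_congr hae, integral_congr_ae hae, integrable_indicator_iff hA,
    integral_indicator hA, ← map_departure hC hΩo hG t,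
    integral_map measurable_departure.aemeasurable hf0.aestronglyMeasurable,
    integral_withDensity_eq_integral_toReal_smul hJ hJt]
  refine ⟨?_, rfl⟩
  exact (integrable_withDensity_iff_integrable_smul' hJ hJt).1
    (hf0.comp_measurable measurable_departure)

/-- By the fundamental theorem of calculus for absolutely continuous functions, the accumulated
density is the time integral of the accumulation rate. -/
theorem accumulated_ae_eq (h : IsStickingTransportSolution Ω f fG) {t : ℝ} (ht : 0 ≤ t) :
    (fun p : Eucl C × Eucl C => fG p.1 p.2 t) =ᵐ[(surfaceMeasure Ω).prod volume]
      fun p => fG p.1 p.2 0 + ∫ s, accumulationRate Ω f t (p, s) := by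
  filter_upwards [h.accumulation] with p hp
  have h1 := (hp.1 t ht).integral_deriv_eq_sub
  have h2 : ∫ s, accumulationRate Ω f t (p, s) = ∫ s in (0 : ℝ)..t, deriv (fG p.1 p.2) s := by
    rw [intervalIntegral.integral_of_le ht]
    have e : (fun s => accumulationRate Ω f t (p, s)) = (Ioc 0 t).indicator
      (fun s => max (inner ℝ p.2 (outwardNormal Ω p.1)) 0 * f p.1 p.2 s) := rfl
    rw [e, integral_indicator measurableSet_Ioc]
    refine setIntegral_congr_ae measurableSet_Ioc ?_
    filter_upwards [hp.2] with s hs hst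
    exact (hs hst.1).deriv.symm
  rw [h2, h1]
  ring

/-! ### Mass balance -/

theorem restrict_prod_volume_eq (Ω : Set (Eucl C)) :
    ((volume : Measure (Eucl C)).restrict Ω).prod (volume : Measure (Eucl C)) =
      (volume : Measure (Eucl C × Eucl C)).restrict (Ω ×ˢ univ) := by
  conv_lhs => rw [← Measure.restrict_univ (μ := (volume : Measure (Eucl C)))]
  rw [Measure.restrict_univ, Measure.volume_eq_prod, ← Measure.prod_restrict, Measure.restrict_univ]

theorem survivors_subset {t : ℝ} (ht : 0 ≤ t) : survivors Ω t ⊆ Ω ×ˢ univ := by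
  intro p hp
  exact ⟨by simpa using hp 0 ⟨le_rfl, ht⟩, trivial⟩

theorem survivors_union_leavers {t : ℝ} (ht : 0 ≤ t) :
    survivors Ω t ∪ leavers Ω t = Ω ×ˢ univ := by
  refine Subset.antisymm (union_subset (survivors_subset ht) fun p hp => ⟨hp.1, trivial⟩) ?_
  intro p hp
  by_cases h : p ∈ survivors Ω t
  · exact Or.inl h
  · exact Or.inr ⟨hp.1, h⟩

theorem interior_ae_eq (hC : 1 ≤ C) (hΩo : IsOpen Ω) (hG : HasAEC1Boundary Ω)
    (h : IsStickingTransportSolution Ω f fG) {t : ℝ} (ht : 0 ≤ t) :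
    (Ω ×ˢ univ).indicator (fun p : Eucl C × Eucl C => f p.1 p.2 t) =ᵐ[volume]
      fun p => (survivors Ω t).indicator (fun p => f p.1 p.2 0) (freeFlightFlow (-t) p) := by
  have hf : ∀ τ : ℝ, Measurable fun p : Eucl C × Eucl C => f p.1 p.2 τ := fun τ =>
    h.measurable.comp (f := fun p : Eucl C × Eucl C => (p.1, p.2, τ)) (by fun_prop)
  have hm1 : Measurable ((Ω ×ˢ univ).indicator (fun p : Eucl C × Eucl C => f p.1 p.2 t)) :=
    (hf t).indicator (hΩo.measurableSet.prod .univ)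
  have hm2 : Measurable fun p =>
      (survivors Ω t).indicator (fun p => f p.1 p.2 0) (freeFlightFlow (-t) p) :=
    ((hf 0).indicator (isOpen_survivors hΩo t).measurableSet).comp
      (continuous_freeFlightFlow (-t)).measurable
  refine ae_phase hC (measurableSet_eq_fun hm1 hm2) fun v hv => ?_
  have h1 : ∀ᵐ x : Eucl C, x - t • v ∉ frontier Ω :=
    (measurePreserving_sub_right volume (t • v)).quasiMeasurePreserving.ae
      (measure_eq_zero_iff_ae_notMem.1 (volume_frontier_eq_zero hC hΩo hG))
  filter_upwards [h1, measure_eq_zero_iff_ae_notMem.1 (volume_badLines hΩo hG hv)] with x hx1 hx2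
  exact h.interior_eq hΩo ht hx2 hx1

theorem interiorMass_eq (hC : 1 ≤ C) (hΩo : IsOpen Ω) (hG : HasAEC1Boundary Ω)
    (h : IsStickingTransportSolution Ω f fG) {t : ℝ} (ht : 0 ≤ t)
    (hf0 : IntegrableOn (fun p : Eucl C × Eucl C => f p.1 p.2 0) (Ω ×ˢ univ)) :
    Integrable (fun p : Eucl C × Eucl C => f p.1 p.2 t) ((volume.restrict Ω).prod volume) ∧
      interiorMass Ω f t = ∫ p in survivors Ω t, f p.1 p.2 0 := by
  have hS := (isOpen_survivors hΩo t).measurableSet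
  have hΩm : MeasurableSet (Ω ×ˢ (univ : Set (Eucl C))) := hΩo.measurableSet.prod .univ
  have hae := interior_ae_eq hC hΩo hG h ht
  have hI : Integrable ((survivors Ω t).indicator fun p : Eucl C × Eucl C => f p.1 p.2 0) :=
    (integrable_indicator_iff hS).2 (hf0.mono_set (survivors_subset ht))
  have hmp := measurePreserving_freeFlightFlow (C := C) (-t)
  have h1 : Integrable (fun p : Eucl C × Eucl C => f p.1 p.2 t)
      ((volume.restrict Ω).prod volume) := by
    rw [restrict_prod_volume_eq]
    refine (integrable_indicator_iff hΩm).1 ((integrable_congr hae).2 ?_)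
    exact hmp.integrable_comp_of_integrable hI
  refine ⟨h1, ?_⟩
  rw [interiorMass, ← integral_prod _ h1, restrict_prod_volume_eq, ← integral_indicator hΩm,
    integral_congr_ae hae, ← integral_indicator hS]
  have := integral_map (μ := volume) (φ := (freeFlightFlow (-t) : Eucl C × Eucl C → _))
    hmp.measurable.aemeasurable (f := (survivors Ω t).indicator fun p => f p.1 p.2 0)
    (by rw [hmp.map_eq]; exact hI.aestronglyMeasurable)
  rw [hmp.map_eq] at this
  exact this.symm

theorem boundaryMass_eq (hC : 1 ≤ C) (hΩo : IsOpen Ω) (hG : HasAEC1Boundary Ω)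
    (h : IsStickingTransportSolution Ω f fG) {t : ℝ} (ht : 0 ≤ t)
    (hf0 : IntegrableOn (fun p : Eucl C × Eucl C => f p.1 p.2 0) (Ω ×ˢ univ))
    (hfG : Integrable (fun p : Eucl C × Eucl C => fG p.1 p.2 0)
      ((surfaceMeasure Ω).prod volume)) :
    Integrable (fun p : Eucl C × Eucl C => fG p.1 p.2 t) ((surfaceMeasure Ω).prod volume) ∧
      boundaryMass Ω fG t = boundaryMass Ω fG 0 + ∫ p in leavers Ω t, f p.1 p.2 0 := by
  have := sigmaFinite_surfaceMeasure hΩo hG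
  obtain ⟨hI, hIe⟩ := integrable_accumulationRate hC hΩo hG h t
    (hf0.mono_set fun p hp => ⟨hp.1, trivial⟩)
  have hae := accumulated_ae_eq h ht
  have h1 : Integrable (fun p : Eucl C × Eucl C => fG p.1 p.2 t)
      ((surfaceMeasure Ω).prod volume) :=
    (integrable_congr hae).2 (hfG.add hI.integral_prod_left)
  refine ⟨h1, ?_⟩
  rw [boundaryMass, boundaryMass, ← integral_prod _ h1, ← integral_prod _ hfG,
    integral_congr_ae hae, integral_add hfG hI.integral_prod_left, ← integral_prod _ hI, hIe]

end Mass

end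

theorem proposition1 (C : ℕ) (hC : 1 ≤ C) :
    -- the free-flight flow, which is generated by the field `(v, 0)`, is divergence-free
    (∀ (p : Eucl C × Eucl C) (t : ℝ),
      HasDerivAt (fun s : ℝ => freeFlightFlow s p) (freeFlightField (freeFlightFlow t p)) t) ∧
    (∀ p : Eucl C × Eucl C, phaseDivergence freeFlightField p = 0) ∧
    (∀ t : ℝ, MeasurePreserving (freeFlightFlow t : Eucl C × Eucl C → Eucl C × Eucl C)
      volume volume) ∧
    -- the transport equation is in conservation form: `v · ∇ₓ g = div (g (v, 0))`
    (∀ (g : Eucl C × Eucl C → ℝ) (p : Eucl C × Eucl C), DifferentiableAt ℝ g p →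
      inner ℝ p.2 (gradient (fun x : Eucl C => g (x, p.2)) p.1) =
        phaseDivergence (fun q => g q • freeFlightField q) p) ∧
    -- with a sticking boundary, the total mass is conserved
    (∀ (Ω : Set (Eucl C)), IsOpen Ω → HasAEC1Boundary Ω →
      ∀ (f fG : Eucl C → Eucl C → ℝ → ℝ), IsStickingTransportSolution Ω f fG →
      Integrable (fun p : Eucl C × Eucl C => f p.1 p.2 0) ((volume.restrict Ω).prod volume) →
      Integrable (fun p : Eucl C × Eucl C => fG p.1 p.2 0) ((surfaceMeasure Ω).prod volume) →
      (∀ t : ℝ, 0 ≤ t →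
        Integrable (fun p : Eucl C × Eucl C => f p.1 p.2 t) ((volume.restrict Ω).prod volume) ∧
        Integrable (fun p : Eucl C × Eucl C => fG p.1 p.2 t) ((surfaceMeasure Ω).prod volume) ∧
        interiorMass Ω f t + boundaryMass Ω fG t = interiorMass Ω f 0 + boundaryMass Ω fG 0 ∧
        HasDerivWithinAt (fun s : ℝ => interiorMass Ω f s + boundaryMass Ω fG s) 0 (Set.Ici 0) t) ∧
      -- and a nonnegative mass is redistributed from the interior to the boundary
      ((∀ x ∈ Ω, ∀ v : Eucl C, 0 ≤ f x v 0) →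
        AntitoneOn (interiorMass Ω f) (Set.Ici 0) ∧
        MonotoneOn (boundaryMass Ω fG) (Set.Ici 0))) := by
  refine ⟨hasDerivAt_freeFlightFlow, phaseDivergence_freeFlightField,
    measurePreserving_freeFlightFlow, inner_gradient_eq_phaseDivergence, ?_⟩
  intro Ω hΩo hG f fG h hf hfG
  have hf0 : IntegrableOn (fun p : Eucl C × Eucl C => f p.1 p.2 0) (Ω ×ˢ univ) := by
    rwa [restrict_prod_volume_eq] at hf
  have hint := fun {t : ℝ} (ht : 0 ≤ t) => interiorMass_eq hC hΩo hG h ht hf0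
  have hbdy := fun {t : ℝ} (ht : 0 ≤ t) => boundaryMass_eq hC hΩo hG h ht hf0 hfG
  have hm0 : interiorMass Ω f 0 = ∫ p in Ω ×ˢ univ, f p.1 p.2 0 := by
    rw [interiorMass, ← integral_prod _ hf, restrict_prod_volume_eq]
  have htot : ∀ {t : ℝ}, 0 ≤ t → interiorMass Ω f t + boundaryMass Ω fG t =
      interiorMass Ω f 0 + boundaryMass Ω fG 0 := by
    intro t ht
    -- every particle initially in `Ω` is either still there at time `t` or has left
    have hd : Disjoint (survivors Ω t) (leavers Ω t) :=
      Set.disjoint_left.2 fun p hp hp' => hp'.2 hp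
    rw [(hint ht).2, (hbdy ht).2, hm0, ← survivors_union_leavers ht,
      setIntegral_union hd (measurableSet_leavers hΩo t)
        (hf0.mono_set (survivors_subset ht))
        (hf0.mono_set fun p hp => ⟨hp.1, trivial⟩)]
    ring
  refine ⟨fun t ht => ⟨(hint ht).1, (hbdy ht).1, htot ht, ?_⟩, fun hpos => ?_⟩
  · exact (hasDerivWithinAt_const t (Ici 0) _).congr (fun s hs => htot hs) (htot ht)
  have hanti : AntitoneOn (interiorMass Ω f) (Ici 0) := by
    intro s hs t ht hst
    rw [(hint hs).2, (hint ht).2]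
    refine setIntegral_mono_set (hf0.mono_set (survivors_subset hs)) ?_
      (Eventually.of_forall fun p hp r hr => hp r ⟨hr.1, hr.2.trans hst⟩)
    refine (ae_restrict_iff' (isOpen_survivors hΩo s).measurableSet).2
      (Eventually.of_forall fun p hp => ?_)
    exact hpos p.1 (survivors_subset hs hp).1 p.2
  refine ⟨hanti, fun s hs t ht hst => ?_⟩
  linarith [hanti hs ht hst, htot hs, htot ht]
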